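/- Let $G=\mathrm{SL}_n(\mathbb C)$, let $N\subset G$ be the group of upper unitriangular matrices, and let $\mathbb C[N]$ be its coordinate ring, i.e. the polynomial ring in the matrix entries $x_{jk}$, $1\le j<k\le n$. For $1\le i\le n-1$ let $E_i=E_{i,i+1}$ and let $e_i,e_i^*:\mathbb C[N]\to\mathbb C[N]$ be the derivations $$(e_if)(g)=\tfrac{d}{dt}\Big|_{t=0}f(g\exp(tE_i)),\qquad (e_i^*f)(g)=\tfrac{d}{dt}\Big|_{t=0}f(\exp(tE_i)g).$$ Weight vectors in $\mathbb C[N]$ are taken with respect to the action of the diagonal torus by $(t\cdot f)(g)=f(t^{-1}gt)$. For a family $(d_i)$ of locally nilpotent operators and $v\neq 0$ put $\varepsilon_i(v)=\max\{k\in\mathbb N: d_i^kv\ne0\}$. A linear basis $B$ of $\mathbb C[N]$ consisting of weight vectors is called perfect with respect to $(d_i)$ if (a) for all $i$ and $k$ the subspace $\ker d_i^k$ is spanned by $B\cap\ker d_i^k$, and (b) for all $i$ and all $b\in B$, either $d_ib=0$ or there is $b'\in B$ with $d_ib-\varepsilon_i(b)\,b'\in\ker d_i^{\varepsilon_i(b)-1}$.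 A basis $B$ is called biperfect if $1\in B$ and $B$ is perfect with respect to both $(e_i)$ and $(e_i^*)$. Theorem. For each of $G=\mathrm{SL}_2,\mathrm{SL}_3,\mathrm{SL}_4$, the ring $\mathbb C[N]$ has exactly one biperfect basis. Moreover, for $G=\mathrm{SL}_3$, writing $x=x_{12}$, $y=x_{23}$, $z=x_{13}$, it is $$\{x^az^b(xy-z)^c:a,b,c\in\mathbb N\}\cup\{y^az^b(xy-z)^c:a,b,c\in\mathbb N\}.$$ -/

import Mathlib

open MvPolynomial

/-! ### Good and perfect bases -/

section Perfect

variable {V ι P : Type*} [AddCommGroup V] [Module ℂ V]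

/-- The nilpotence degree `max {k : e ^ k v ≠ 0}` of a (locally nilpotent) operator `e` on the
vector `v`. -/
noncomputable def nilDegree (e : Module.End ℂ V) (v : V) : ℕ :=
  sSup {k : ℕ | (e ^ k) v ≠ 0}

/-- A weight basis: a linear basis, regarded as a subset of `V`, all of whose elements lie in one of
the weight spaces `W μ`. -/
structure IsWeightBasis (W : P → Submodule ℂ V) (B : Set V) : Prop where
  linearIndependent : LinearIndepOn ℂ id B
  span_eq_top : Submodule.span ℂ B = ⊤
  weight : ∀ b ∈ B, ∃ μ : P, b ∈ W μ

/-- A good basis: a weight basis compatible with the filtrations by the kernels of the powers of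
the operators `e i`, that is, every such kernel is spanned by the basis vectors it contains. -/
structure IsGoodBasis (W : P → Submodule ℂ V) (e : ι → Module.End ℂ V) (B : Set V) : Prop
    extends IsWeightBasis W B where
  compatible : ∀ (i : ι) (k : ℕ),
    Submodule.span ℂ (B ∩ (LinearMap.ker (e i ^ k) : Set V)) = LinearMap.ker (e i ^ k)

/-- A perfect basis: a good basis such that for all `i` and `b ∈ B` either `e i b = 0`, or
`e i b = ε_i(b) • b' + v` for some `b' ∈ B` and some `v` killed by `(e i) ^ (ε_i(b) - 1)`.
(In the second case `ε_i(b) ≥ 1`, so the subtraction is not truncated.) -/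
structure IsPerfectBasis (W : P → Submodule ℂ V) (e : ι → Module.End ℂ V) (B : Set V) : Prop
    extends IsGoodBasis W e B where
  perfect : ∀ (i : ι), ∀ b ∈ B, e i b = 0 ∨
    ∃ b' ∈ B, ∃ v ∈ LinearMap.ker (e i ^ (nilDegree (e i) b - 1)),
      e i b = (nilDegree (e i) b : ℂ) • b' + v

end Perfect

/-! ### The coordinate ring of the maximal unipotent subgroup of `SL_{r+1}`

`N` is the group of upper unitriangular complex matrices of size `r + 1`; the simple roots are
indexed by `Fin r`, and the `i`-th simple root vector is the matrix unit in position
`(i.castSucc, i.succ)`. -/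

/-- The positions strictly above the diagonal (the positive roots). -/
abbrev PosRoot (r : ℕ) : Type := {p : Fin (r + 1) × Fin (r + 1) // p.1 < p.2}

/-- The coordinate ring `ℂ[N]`: polynomials in the matrix entries above the diagonal. -/
abbrev CoordRing (r : ℕ) : Type := MvPolynomial (PosRoot r) ℂ

/-- The generic element of `N`: the upper unitriangular matrix whose entries above the diagonal are
the coordinate functions. -/
noncomputable def genericMatrix (r : ℕ) : Matrix (Fin (r + 1)) (Fin (r + 1)) (CoordRing r) :=
  Matrix.of fun j k => if h : j < k then X ⟨(j, k), h⟩ else if j = k then 1 else 0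

/-- The simple root vector `E_i`, a matrix unit, with entries viewed as constants of `ℂ[N]`. -/
noncomputable def simpleRootVector (r : ℕ) (i : Fin r) :
    Matrix (Fin (r + 1)) (Fin (r + 1)) (CoordRing r) :=
  Matrix.single i.castSucc i.succ 1

/-- The left action `e_i` of the `i`-th simple root vector `E_i` on `ℂ[N]`, coming from the action
`(h · f)(g) = f (g h)` of `N`: the derivation `(e_i f)(g) = d/dt f (g exp(t E_i))` at `t = 0`. -/
noncomputable def leftE (r : ℕ) (i : Fin r) : Module.End ℂ (CoordRing r) :=
  (MvPolynomial.mkDerivation ℂ fun p : PosRoot r =>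
    (genericMatrix r * simpleRootVector r i) p.1.1 p.1.2 :
      Derivation ℂ (CoordRing r) (CoordRing r))

/-- The right action `e_i^*` of the `i`-th simple root vector `E_i` on `ℂ[N]`, coming from the
action `(f · h)(g) = f (h g)` of `N`: the derivation
`(e_i^* f)(g) = d/dt f (exp(t E_i) g)` at `t = 0`. -/
noncomputable def rightE (r : ℕ) (i : Fin r) : Module.End ℂ (CoordRing r) :=
  (MvPolynomial.mkDerivation ℂ fun p : PosRoot r =>
    (simpleRootVector r i * genericMatrix r) p.1.1 p.1.2 :
      Derivation ℂ (CoordRing r) (CoordRing r))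

/-- The element of `N` with given entries above the diagonal. -/
noncomputable def unipotentOf {r : ℕ} (a : PosRoot r → ℂ) :
    Matrix (Fin (r + 1)) (Fin (r + 1)) ℂ :=
  (genericMatrix r).map (MvPolynomial.eval a)

theorem unipotentOf_apply {r : ℕ} (a : PosRoot r → ℂ) (p : PosRoot r) :
    unipotentOf a p.1.1 p.1.2 = a p := by
  simp [unipotentOf, genericMatrix, p.2]

/-- A polynomial function along a differentiable curve; used for the next two facts. -/
theorem hasDerivAt_eval_mkDerivation {σ : Type*} (c : ℂ → σ → ℂ) (a : σ → ℂ)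
    (v : σ → MvPolynomial σ ℂ) (h0 : c 0 = a)
    (hc : ∀ p, HasDerivAt (fun t => c t p) (eval a (v p)) 0) (f : MvPolynomial σ ℂ) :
    HasDerivAt (fun t => eval (c t) f) (eval a (mkDerivation ℂ v f)) 0 := by
  induction f using MvPolynomial.induction_on with
  | C x => simpa using hasDerivAt_const (0 : ℂ) x
  | add p q hp hq =>
    simp only [map_add]
    exact hp.add hq
  | mul_X p n hp =>
    have h := hp.fun_mul (hc n)
    simp only [h0] at h
    simp only [Derivation.leibniz, mkDerivation_X, smul_eq_mul, map_add, map_mul, eval_X]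
    rwa [mul_comm (a n), add_comm]

/-- `leftE` is differentiation of `f` along `t ↦ g (1 + t E_i) = g exp(t E_i)`, for `g ∈ N`. -/
theorem hasDerivAt_leftE {r : ℕ} (i : Fin r) (a : PosRoot r → ℂ) (f : CoordRing r) :
    HasDerivAt (fun t : ℂ => eval (fun p : PosRoot r =>
        (unipotentOf a * Matrix.transvection i.castSucc i.succ t) p.1.1 p.1.2) f)
      (eval a (leftE r i f)) 0 := by
  refine hasDerivAt_eval_mkDerivation _ a _ ?_ (fun p => ?_) f
  · funext p
    simp [unipotentOf_apply]
  · have : ∀ t : ℂ, (unipotentOf a * Matrix.transvection i.castSucc i.succ t) p.1.1 p.1.2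
        = a p + t * eval a ((genericMatrix r * simpleRootVector r i) p.1.1 p.1.2) := by
      intro t
      rw [Matrix.transvection, mul_add, mul_one, Matrix.add_apply, unipotentOf_apply]
      by_cases h : p.1.2 = i.succ
      · simp [h, unipotentOf, simpleRootVector, mul_comm]
      · simp [h, simpleRootVector]
    simp only [this]
    simpa using ((hasDerivAt_id (0 : ℂ)).mul_const _).const_add (a p)

/-- `rightE` is differentiation of `f` along `t ↦ (1 + t E_i) g = exp(t E_i) g`, for `g ∈ N`. -/
theorem hasDerivAt_rightE {r : ℕ} (i : Fin r) (a : PosRoot r → ℂ) (f : CoordRing r) :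
    HasDerivAt (fun t : ℂ => eval (fun p : PosRoot r =>
        (Matrix.transvection i.castSucc i.succ t * unipotentOf a) p.1.1 p.1.2) f)
      (eval a (rightE r i f)) 0 := by
  refine hasDerivAt_eval_mkDerivation _ a _ ?_ (fun p => ?_) f
  · funext p
    simp [unipotentOf_apply]
  · have : ∀ t : ℂ, (Matrix.transvection i.castSucc i.succ t * unipotentOf a) p.1.1 p.1.2
        = a p + t * eval a ((simpleRootVector r i * genericMatrix r) p.1.1 p.1.2) := by
      intro t
      rw [Matrix.transvection, add_mul, one_mul, Matrix.add_apply, unipotentOf_apply]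
      by_cases h : p.1.1 = i.castSucc
      · simp [h, unipotentOf, simpleRootVector]
      · simp [h, simpleRootVector]
    simp only [this]
    simpa using ((hasDerivAt_id (0 : ℂ)).mul_const _).const_add (a p)

/-- The weight of the coordinate function in position `(j, k)` under the torus action
`(t · f)(g) = f (t⁻¹ g t)`, which multiplies it by `t_j⁻¹ t_k`: the negative root `ε_k - ε_j`. -/
def entryWeight (r : ℕ) (p : PosRoot r) : Fin (r + 1) → ℤ :=
  Pi.single p.1.2 1 - Pi.single p.1.1 1

/-- The weight space of weight `μ` in `ℂ[N]`. -/
noncomputable def weightSpace (r : ℕ) (μ : Fin (r + 1) → ℤ) : Submodule ℂ (CoordRing r) :=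
  MvPolynomial.weightedHomogeneousSubmodule ℂ (entryWeight r) μ

/-- A biperfect basis of `ℂ[N]`, for `G = SL_{r+1}`: it contains `1` and is perfect with respect to
both the left and the right action. -/
structure IsBiperfectBasis (r : ℕ) (B : Set (CoordRing r)) : Prop where
  one_mem : (1 : CoordRing r) ∈ B
  left : IsPerfectBasis (weightSpace r) (leftE r) B
  right : IsPerfectBasis (weightSpace r) (rightE r) B

/-- For `G = SL_3`, with `x`, `y`, `z` the matrix entries in positions `(1,2)`, `(2,3)`, `(1,3)`:
the set of all `x^a z^b (xy - z)^c` and all `y^a z^b (xy - z)^c`. -/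
noncomputable def sl3Basis : Set (CoordRing 2) :=
  let x : CoordRing 2 := genericMatrix 2 0 1
  let y : CoordRing 2 := genericMatrix 2 1 2
  let z : CoordRing 2 := genericMatrix 2 0 2
  {f | ∃ a b c : ℕ, f = x ^ a * z ^ b * (x * y - z) ^ c} ∪
    {f | ∃ a b c : ℕ, f = y ^ a * z ^ b * (x * y - z) ^ c}

/-! ### Perfect bases: general facts and a uniqueness criterion -/

section General

variable {V ι P : Type*} [AddCommGroup V] [Module ℂ V]

/-! Regard the `e_i` and `e_i^*` as one family of locally nilpotent operators `D_i` that lower the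
height of weights, and let `ε_i` be their nilpotence degrees.

Uniqueness (`IsLoweringFamily.perfectBasis_unique`) is by induction on height. Let `B`, `B'` be
perfect and suppose that the elements of `B'` of smaller height lie in `B`. If `b' ∈ B'` has
`ε_i(b') > 0`, its normalized top power under `D_i` is an element of `B'` of smaller height, hence
of `B`, and it is also the top power of some `φ_i(b') ∈ B` of the same weight. So `b'` is `φ_i(b')`
plus elements of `B` with smaller `ε_i`. A nonzero term of the base change determinant gives a
bijection `ψ` such that `ψ(b')` occurs in `b'`. Then `ε_i(ψ(b')) ≤ ε_i(b')`, and counting forces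
equality, so `ψ(b') = φ_i(b')` whenever `ε_i(b') > 0`. Any other vector occurring in `b'` is
strictly below `ψ(b')` for every `ε_i` that is nonzero there. If `B` has no such comparable pairs,
`b'` is a multiple of `ψ(b')`, and the leading coefficient, or the condition `1 ∈ B'`, makes the
factor 1.

Existence (`isPerfectBasis_range`): suppose that top powers send a basis to itself up to factorials,
injectively for each fixed degree. Then the kernels of powers are spanned by basis vectors, and
surjectivity of `D_i` (a locally nilpotent derivation with a slice) gives the second axiom of
perfectness.

The models consist of monomials in minors: powers of `x` for `SL_2`, monomials in `x, y, z, xy - z`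
not divisible by `xy` for `SL_3`, and for `SL_4` monomials in twelve minors without crossing pairs.
Three of the twelve cross nothing; the other nine cross exactly as the diagonals of a hexagon do.
Leading monomials show that these are bases; the conditions of both criteria become integer
arithmetic with exponents. -/

theorem nilDegree_eq {e : Module.End ℂ V} {v : V} {n : ℕ} (h : (e ^ n) v ≠ 0)
    (h' : (e ^ (n + 1)) v = 0) : nilDegree e v = n := by
  have hz : ∀ k, n + 1 ≤ k → (e ^ k) v = 0 := fun k hk => by
    obtain ⟨m, rfl⟩ := Nat.exists_eq_add_of_le' hk
    rw [pow_add, Module.End.mul_apply, h', map_zero]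
  have hub : ∀ k ∈ {k : ℕ | (e ^ k) v ≠ 0}, k ≤ n := fun k hk => by
    by_contra hlt
    exact hk (hz k (by omega))
  exact le_antisymm (csSup_le ⟨n, h⟩ hub) (le_csSup ⟨n, hub⟩ h)

theorem exists_pow_ne_zero_and_pow_succ_eq_zero {e : Module.End ℂ V} {v : V}
    (he : ∃ k, (e ^ k) v = 0) (hv : v ≠ 0) : ∃ n, (e ^ n) v ≠ 0 ∧ (e ^ (n + 1)) v = 0 := by
  classical
  have hpos : Nat.find he ≠ 0 := fun h0 => hv (by simpa [h0] using Nat.find_spec he)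
  obtain ⟨m, hm⟩ := Nat.exists_eq_succ_of_ne_zero hpos
  exact ⟨m, Nat.find_min he (by omega), by simpa [hm] using Nat.find_spec he⟩

theorem pow_apply_eq_zero_iff {e : Module.End ℂ V} {v : V} (he : ∃ k, (e ^ k) v = 0)
    (hv : v ≠ 0) {k : ℕ} : (e ^ k) v = 0 ↔ nilDegree e v < k := by
  obtain ⟨n, hn, hn'⟩ := exists_pow_ne_zero_and_pow_succ_eq_zero he hv
  rw [nilDegree_eq hn hn']
  constructor
  · intro h
    by_contra hlt
    obtain ⟨m, rfl⟩ := Nat.exists_eq_add_of_le' (not_lt.1 hlt)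
    exact hn (by rw [pow_add, Module.End.mul_apply, h, map_zero])
  · intro h
    obtain ⟨m, rfl⟩ := Nat.exists_eq_add_of_le' (Nat.succ_le_of_lt h)
    rw [pow_add, Module.End.mul_apply, hn', map_zero]

theorem mem_of_mem_span_subset {B s : Set V} {a : V} (hB : LinearIndepOn ℂ id B) (hs : s ⊆ B)
    (ha : a ∈ B) (h : a ∈ Submodule.span ℂ s) : a ∈ s :=
  (hB.mono hs).mem_span_iff_id.1 h (hB.mono (Set.insert_subset ha hs))

theorem mem_of_coe_mem_map_subtype {U : Submodule ℂ V} {S : Submodule ℂ U} {x : U}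
    (h : (x : V) ∈ S.map U.subtype) : x ∈ S := by
  obtain ⟨y, hy, hyx⟩ := h
  rwa [← Subtype.ext hyx]

theorem IsWeightBasis.ne_zero {W : P → Submodule ℂ V} {B : Set V} (hB : IsWeightBasis W B)
    {b : V} (hb : b ∈ B) : b ≠ 0 := by
  rintro rfl
  exact hB.linearIndependent.zero_notMem_image ⟨0, hb, rfl⟩

/-! ### Top powers on a perfect basis -/

namespace IsPerfectBasis

variable {W : P → Submodule ℂ V} {e : ι → Module.End ℂ V} {B : Set V}

/-- The normalized top power `e i ^ n b / n!` of a basis vector is again a basis vector. -/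
theorem exists_top (hB : IsPerfectBasis W e B) (hnil : ∀ i v, ∃ k, (e i ^ k) v = 0) (i : ι) :
    ∀ (n : ℕ), ∀ b ∈ B, nilDegree (e i) b = n → ∃ t ∈ B, (e i ^ n) b = (n.factorial : ℂ) • t := by
  intro n
  induction n with
  | zero => exact fun b hb _ => ⟨b, hb, by simp⟩
  | succ n ih =>
    intro b hb hn
    have key := fun k => pow_apply_eq_zero_iff (hnil i b) (hB.ne_zero hb) (k := k)
    rw [hn] at key
    obtain h0 | ⟨b', hb', v, hv, hbv⟩ := hB.perfect i b hb
    · have := (key 1).1 (by simpa using h0)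
      omega
    · rw [hn] at hv hbv
      have hv : (e i ^ n) v = 0 := by simpa using hv
      -- The error term `v` is killed by `e i ^ n`, hence by every higher power.
      have hpow : ∀ m, n ≤ m → (e i ^ (m + 1)) b = ((n + 1 : ℕ) : ℂ) • (e i ^ m) b' := by
        intro m hm
        obtain ⟨l, rfl⟩ := Nat.exists_eq_add_of_le' hm
        rw [pow_succ, Module.End.mul_apply, hbv, map_add, map_smul, pow_add, Module.End.mul_apply,
          Module.End.mul_apply, hv, map_zero, add_zero]
      have hne : ((n + 1 : ℕ) : ℂ) ≠ 0 := by exact_mod_cast n.succ_ne_zero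
      have hnd : nilDegree (e i) b' = n := by
        apply nilDegree_eq
        · intro h
          have h1 := hpow n le_rfl
          rw [h, smul_zero, key] at h1
          omega
        · have h1 := hpow (n + 1) (by omega)
          rw [(key (n + 1 + 1)).2 (by omega)] at h1
          exact (smul_eq_zero.1 h1.symm).resolve_left hne
      obtain ⟨t, ht, htb⟩ := ih b' hb' hnd
      refine ⟨t, ht, ?_⟩
      rw [hpow n le_rfl, htb, smul_smul, Nat.factorial_succ, Nat.cast_mul]

/-- The difference `b - c` lies in the span of `B ∩ ker (e i ^ n)`. By linear independence `b` is
then `c` or an element of this kernel, and the latter contradicts its degree `n`. -/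
theorem eq_of_pow_eq (hB : IsPerfectBasis W e B) (hnil : ∀ i v, ∃ k, (e i ^ k) v = 0) {i : ι}
    {n : ℕ} {b c : V} (hb : b ∈ B) (hc : c ∈ B) (hnb : nilDegree (e i) b = n)
    (h : (e i ^ n) b = (e i ^ n) c) : b = c := by
  have h1 : b - c ∈ Submodule.span ℂ (B ∩ (LinearMap.ker (e i ^ n) : Set V)) := by
    rw [hB.compatible i n]
    simp [h]
  have h2 : b ∈ Submodule.span ℂ (insert c (B ∩ (LinearMap.ker (e i ^ n) : Set V))) := by
    rw [← sub_add_cancel b c]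
    exact add_mem (Submodule.span_mono (Set.subset_insert _ _) h1)
      (Submodule.subset_span (Set.mem_insert _ _))
  obtain h3 | h3 := mem_of_mem_span_subset hB.linearIndependent
    (Set.insert_subset hc Set.inter_subset_left) hb h2
  · exact h3
  · have := (pow_apply_eq_zero_iff (hnil i b) (hB.ne_zero hb)).1 h3.2
    omega

end IsPerfectBasis

/-- Weight spaces `W` graded by a height, on which the locally nilpotent operators `D` act by
lowering the height. -/
structure IsLoweringFamily (W : P → Submodule ℂ V) (D : ι → Module.End ℂ V) (ht : P → ℕ) :
    Prop where
  exists_proj : ∀ μ, ∃ π : V →ₗ[ℂ] V, (∀ v ∈ W μ, π v = v) ∧ ∀ ν ≠ μ, ∀ v ∈ W ν, π v = 0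
  finite : ∀ μ, FiniteDimensional ℂ (W μ)
  lower : ∀ i μ, ∀ v ∈ W μ, D i v ≠ 0 → ∃ ν, ht ν < ht μ ∧ D i v ∈ W ν
  nilpotent : ∀ i v, ∃ k, (D i ^ k) v = 0

/-! ### Comparison of two perfect bases, weight by weight -/

namespace IsLoweringFamily

variable {W : P → Submodule ℂ V} {D : ι → Module.End ℂ V} {ht : P → ℕ}

theorem mem_span_inter (hD : IsLoweringFamily W D ht) {s : Set V} (hs : ∀ b ∈ s, ∃ μ, b ∈ W μ)
    {μ : P} {v : V} (hv : v ∈ Submodule.span ℂ s) (hμ : v ∈ W μ) :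
    v ∈ Submodule.span ℂ (s ∩ (W μ : Set V)) := by
  obtain ⟨π, h1, h2⟩ := hD.exists_proj μ
  rw [← h1 v hμ]
  have := Submodule.mem_map_of_mem (f := π) hv
  rw [Submodule.map_span] at this
  refine Submodule.span_le.2 ?_ this
  rintro _ ⟨b, hb, rfl⟩
  obtain ⟨ν, hν⟩ := hs b hb
  by_cases h : ν = μ
  · subst h
    rw [h1 b hν]
    exact Submodule.subset_span ⟨hb, hν⟩
  · rw [h2 ν h b hν]
    exact zero_mem _

theorem lower_pow (hD : IsLoweringFamily W D ht) (i : ι) (n : ℕ) {μ : P} {v : V} (hv : v ∈ W μ)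
    (h : (D i ^ (n + 1)) v ≠ 0) : ∃ ν, ht ν < ht μ ∧ (D i ^ (n + 1)) v ∈ W ν := by
  induction n with
  | zero => simpa using hD.lower i μ v hv (by simpa using h)
  | succ n ih =>
    rw [pow_succ', Module.End.mul_apply] at h ⊢
    obtain ⟨ν, hν, hm⟩ := ih (fun h0 => h (by rw [h0, map_zero]))
    obtain ⟨κ, hκ, hm'⟩ := hD.lower i ν _ hm h
    exact ⟨κ, hκ.trans hν, hm'⟩

/-- If the perfect basis `B` contains the vectors of the perfect basis `B'` of smaller height, then
each `b' ∈ B'` with `D i b' ≠ 0` has a leading term in `B` with respect to `D i`. -/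
theorem exists_leading (hD : IsLoweringFamily W D ht) {B B' : Set V} (hB : IsPerfectBasis W D B)
    (hB' : IsPerfectBasis W D B') {μ : P}
    (hlow : ∀ ν, ht ν < ht μ → ∀ b ∈ B', b ∈ W ν → b ∈ B) (i : ι) {b' : V} (hb' : b' ∈ B')
    (hμ : b' ∈ W μ) (hpos : 0 < nilDegree (D i) b') :
    ∃ b ∈ B, b ∈ W μ ∧ nilDegree (D i) b = nilDegree (D i) b' ∧
      (D i ^ nilDegree (D i) b') b = (D i ^ nilDegree (D i) b') b' := by
  have hnil := hD.nilpotent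
  obtain ⟨n, hn⟩ : ∃ n, nilDegree (D i) b' = n + 1 := ⟨nilDegree (D i) b' - 1, by omega⟩
  rw [hn]
  have key := fun k => pow_apply_eq_zero_iff (hnil i b') (hB'.ne_zero hb') (k := k)
  rw [hn] at key
  have hfac : ((n + 1).factorial : ℂ) ≠ 0 := by exact_mod_cast (n + 1).factorial_ne_zero
  have hne : (D i ^ (n + 1)) b' ≠ 0 := fun h => by
    have := (key _).1 h
    omega
  obtain ⟨t, ht', htb⟩ := hB'.exists_top hnil i (n + 1) b' hb' hn
  obtain ⟨ν, hν, hm⟩ := hD.lower_pow i n hμ hne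
  have htB : t ∈ B := by
    refine hlow ν hν t ht' ?_
    rw [htb] at hm
    exact (Submodule.smul_mem_iff _ hfac).1 hm
  have h1 : b' ∈ Submodule.span ℂ (B ∩ (LinearMap.ker (D i ^ (n + 2)) : Set V)) := by
    rw [hB.compatible i (n + 2)]
    exact (key _).2 (by omega)
  have h2 := hD.mem_span_inter (fun b hb => hB.weight b hb.1) h1 hμ
  -- `T` is the set of tops of the vectors of `B` of weight `μ` and degree `n + 1`. Applying `D i ^
  -- (n + 1)` to the expansion of `b'` kills all terms of smaller degree, so the top of `b'` lies in
  -- the span of `T`; being in `B`, it lies in `T` itself.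
  let T : Set V := {t | t ∈ B ∧ ∃ b ∈ B, b ∈ W μ ∧ nilDegree (D i) b = n + 1 ∧
    (D i ^ (n + 1)) b = ((n + 1).factorial : ℂ) • t}
  have h3 : (D i ^ (n + 1)) b' ∈ Submodule.span ℂ T := by
    have := Submodule.mem_map_of_mem (f := D i ^ (n + 1)) h2
    rw [Submodule.map_span] at this
    refine Submodule.span_le.2 ?_ this
    rintro _ ⟨b, ⟨⟨hb, hbk⟩, hbμ⟩, rfl⟩
    have hlt := (pow_apply_eq_zero_iff (hnil i b) (hB.ne_zero hb)).1 hbk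
    by_cases heq : nilDegree (D i) b = n + 1
    · obtain ⟨s, hs, hsb⟩ := hB.exists_top hnil i (n + 1) b hb heq
      rw [hsb]
      exact Submodule.smul_mem _ _ (Submodule.subset_span ⟨hs, b, hb, hbμ, heq, hsb⟩)
    · rw [(pow_apply_eq_zero_iff (hnil i b) (hB.ne_zero hb)).2 (by omega)]
      exact zero_mem _
  rw [htb, Submodule.smul_mem_iff _ hfac] at h3
  obtain ⟨_, b, hb, hbμ, hbn, hbt⟩ :=
    mem_of_mem_span_subset hB.linearIndependent (fun _ h => h.1) htB h3
  exact ⟨b, hb, hbμ, hbn, by rw [hbt, htb]⟩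

/-- The vectors of weight `μ` in a weight basis form a basis of the weight space. -/
noncomputable def weightBasis (hD : IsLoweringFamily W D ht) {B : Set V} (hB : IsWeightBasis W B)
    (μ : P) : Module.Basis ↥(B ∩ (W μ : Set V)) ℂ (W μ) :=
  Module.Basis.mk (v := fun b => (⟨b.1, b.2.2⟩ : W μ))
    (LinearIndependent.of_comp (W μ).subtype (hB.linearIndependent.mono Set.inter_subset_left))
    (by
      rintro ⟨x, hx⟩ -
      have h1 : x ∈ Submodule.span ℂ (B ∩ (W μ : Set V)) :=
        hD.mem_span_inter hB.weight (by rw [hB.span_eq_top]; trivial) hx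
      apply mem_of_coe_mem_map_subtype
      rw [Submodule.map_span, ← Set.range_comp]
      convert h1
      ext y
      simp [Set.mem_inter_iff])

@[simp]
theorem weightBasis_apply (hD : IsLoweringFamily W D ht) {B : Set V} (hB : IsWeightBasis W B)
    (μ : P) (b : ↥(B ∩ (W μ : Set V))) : (hD.weightBasis hB μ b : V) = b := by
  simp [weightBasis]

/-- Compatibility with kernels, in coordinates on one weight space: an expansion of a vector of the
kernel uses only basis vectors of the kernel. -/
theorem mem_ker_of_repr_ne_zero (hD : IsLoweringFamily W D ht) {B : Set V}
    (hB : IsPerfectBasis W D B) {μ : P} {i : ι} {k : ℕ} {x : W μ} (hx : (D i ^ k) x = 0)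
    {b : ↥(B ∩ (W μ : Set V))} (hb : (hD.weightBasis hB.toIsWeightBasis μ).repr x b ≠ 0) :
    (D i ^ k) b = 0 := by
  set β := hD.weightBasis hB.toIsWeightBasis μ
  have h1 : (x : V) ∈ Submodule.span ℂ (B ∩ (LinearMap.ker (D i ^ k) : Set V)) := by
    rw [hB.compatible i k]
    exact hx
  have h2 := hD.mem_span_inter (fun b hb => hB.weight b hb.1) h1 x.2
  have h3 : x ∈ Submodule.span ℂ (β '' {b | (D i ^ k) b = 0}) := by
    apply mem_of_coe_mem_map_subtype
    rw [Submodule.map_span]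
    refine Submodule.span_mono ?_ h2
    rintro c ⟨⟨hc, hck⟩, hcμ⟩
    exact ⟨β ⟨c, hc, hcμ⟩, ⟨⟨c, hc, hcμ⟩, hck, rfl⟩, by simp [β]⟩
  rw [Module.Basis.mem_span_image] at h3
  exact h3 (by simpa using hb)

end IsLoweringFamily

/-- Two finite bases can be matched so that matched vectors occur in each other's expansion. -/
theorem Module.Basis.exists_equiv_repr_ne_zero {κ κ' : Type*} [Finite κ] [Finite κ']
    (β : Module.Basis κ ℂ V) (β' : Module.Basis κ' ℂ V) :
    ∃ ψ : κ' ≃ κ, ∀ j, β.repr (β' j) (ψ j) ≠ 0 := by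
  classical
  cases nonempty_fintype κ
  cases nonempty_fintype κ'
  let e := β'.indexEquiv β
  have h := ((β.reindex e.symm).isUnit_det β').ne_zero
  rw [Module.Basis.det_apply, Matrix.det_apply] at h
  -- A nonzero determinant has a nonzero term in its Leibniz expansion; the permutation of that term
  -- is the matching.
  obtain ⟨σ, -, hσ⟩ := Finset.exists_ne_zero_of_sum_ne_zero h
  have h2 : ∏ i, (β.reindex e.symm).toMatrix β' (σ i) i ≠ 0 := fun h0 => hσ (by rw [h0, smul_zero])
  refine ⟨σ.trans e, fun j => ?_⟩
  simpa [Module.Basis.toMatrix_apply] using Finset.prod_ne_zero_iff.1 h2 j (Finset.mem_univ _)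

/-- A uniqueness criterion for perfect bases: a perfect basis `B` is the only one containing `o` if
`o` is its only vector killed by all operators, and if no two of its vectors of the same weight are
strictly comparable with respect to all nilpotence degrees. -/
theorem IsLoweringFamily.perfectBasis_unique {W : P → Submodule ℂ V} {D : ι → Module.End ℂ V}
    {ht : P → ℕ} (hD : IsLoweringFamily W D ht) {B B' : Set V} (hB : IsPerfectBasis W D B)
    (hB' : IsPerfectBasis W D B') {o : V} (ho' : o ∈ B')
    (hker : ∀ b ∈ B, (∀ i, D i b = 0) → b = o)
    (hcomp : ∀ μ, ∀ b ∈ B, ∀ c ∈ B, b ∈ W μ → c ∈ W μ →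
      (∀ i, nilDegree (D i) b < nilDegree (D i) c ∨ D i b = 0 ∧ D i c = 0) → b = c) :
    B' = B := by
  have hnil := hD.nilpotent
  have hzero : ∀ {b : V}, b ≠ 0 → ∀ i, nilDegree (D i) b = 0 ↔ D i b = 0 := fun hb i => by
    have := pow_apply_eq_zero_iff (hnil i _) hb (k := 1)
    rw [pow_one] at this
    rw [this]
    omega
  -- One inclusion is enough: a spanning set contained in a linearly independent set is all of it.
  suffices hsub : ∀ n μ, ht μ = n → ∀ b ∈ B', b ∈ W μ → b ∈ B by
    have hle : B' ⊆ B := fun b hb => by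
      obtain ⟨μ, hμ⟩ := hB'.weight b hb
      exact hsub _ μ rfl b hb hμ
    refine hle.antisymm fun b hb => mem_of_mem_span_subset hB.linearIndependent hle hb ?_
    rw [hB'.span_eq_top]
    trivial
  intro n
  induction n using Nat.strong_induction_on with
  | _ n ih =>
  rintro μ rfl
  have hlow : ∀ ν, ht ν < ht μ → ∀ b ∈ B', b ∈ W ν → b ∈ B := fun ν hν => ih _ hν ν rfl
  have := hD.finite μ
  set β := hD.weightBasis hB.toIsWeightBasis μ with hβ
  set β' := hD.weightBasis hB'.toIsWeightBasis μ with hβ'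
  have hfin : Finite ↥(B ∩ (W μ : Set V)) := Module.Finite.finite_basis β
  have hfin' : Finite ↥(B' ∩ (W μ : Set V)) := Module.Finite.finite_basis β'
  cases nonempty_fintype ↥(B ∩ (W μ : Set V))
  cases nonempty_fintype ↥(B' ∩ (W μ : Set V))
  classical
  have hcoe : ∀ b, (β b : V) = b := fun b => hD.weightBasis_apply _ μ b
  have hcoe' : ∀ b, (β' b : V) = b := fun b => hD.weightBasis_apply _ μ b
  have hle : ∀ i b' b, β.repr (β' b') b ≠ 0 →
      nilDegree (D i) (b : V) ≤ nilDegree (D i) (b' : V) := by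
    intro i b' b h
    have := hD.mem_ker_of_repr_ne_zero hB (i := i) (k := nilDegree (D i) (b' : V) + 1)
      (x := β' b') (by
        rw [hcoe', pow_apply_eq_zero_iff (hnil i _) (hB'.ne_zero b'.2.1)]
        omega) h
    rw [pow_apply_eq_zero_iff (hnil i _) (hB.ne_zero b.2.1)] at this
    omega
  have hlead : ∀ i (b' : ↥(B' ∩ (W μ : Set V))), ∃ b : ↥(B ∩ (W μ : Set V)),
      0 < nilDegree (D i) (b' : V) →
      nilDegree (D i) (b : V) = nilDegree (D i) (b' : V) ∧
      (D i ^ nilDegree (D i) (b' : V)) b = (D i ^ nilDegree (D i) (b' : V)) b' := by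
    intro i b'
    by_cases hpos : 0 < nilDegree (D i) (b' : V)
    · obtain ⟨b, hb, hbμ, h⟩ := hD.exists_leading hB hB' hlow i b'.2.1 b'.2.2 hpos
      exact ⟨⟨b, hb, hbμ⟩, fun _ => h⟩
    -- An arbitrary value, present only to make `φ` total.
    · exact ⟨β'.indexEquiv β b', fun h => absurd h hpos⟩
  choose φ hφ using hlead
  -- The difference `b' - φ i b'` is killed by `D i` to the power `nilDegree (D i) b'`, so every
  -- vector other than `φ i b'` occurring in `b'` has smaller degree.
  have hrepr : ∀ i (b' : ↥(B' ∩ (W μ : Set V))) b,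
      0 < nilDegree (D i) (b' : V) → b ≠ φ i b' → β.repr (β' b') b ≠ 0 →
      nilDegree (D i) (b : V) < nilDegree (D i) (b' : V) := by
    intro i b' b hpos hne h
    obtain ⟨-, h2⟩ := hφ i b' hpos
    have := hD.mem_ker_of_repr_ne_zero hB (i := i) (k := nilDegree (D i) (b' : V))
      (x := β' b' - β (φ i b')) (b := b) (by
        rw [Submodule.coe_sub, hcoe, hcoe', map_sub, h2, sub_self]) (by
        rw [← hβ]
        simpa [Finsupp.single_apply, hne.symm] using h)
    rwa [pow_apply_eq_zero_iff (hnil i _) (hB.ne_zero b.2.1)] at this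
  have hone : ∀ i (b' : ↥(B' ∩ (W μ : Set V))),
      0 < nilDegree (D i) (b' : V) → β.repr (β' b') (φ i b') = 1 := by
    intro i b' hpos
    obtain ⟨h1, h2⟩ := hφ i b' hpos
    by_contra h
    have := hD.mem_ker_of_repr_ne_zero hB (i := i) (k := nilDegree (D i) (b' : V))
      (x := β' b' - β (φ i b')) (b := φ i b') (by
        rw [Submodule.coe_sub, hcoe, hcoe', map_sub, h2, sub_self]) (by
        rw [← hβ]
        simpa [sub_eq_zero] using h)
    rw [pow_apply_eq_zero_iff (hnil i _) (hB.ne_zero (φ i b').2.1)] at this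
    omega
  obtain ⟨ψ, hψ⟩ := β.exists_equiv_repr_ne_zero β'
  -- The map `φ i` preserves degrees and is injective on vectors of positive degree, because a
  -- vector of `B'` is determined by its degree and top. So the total degree of `B'` in weight `μ`
  -- is at most that of `B`, while `ψ` does not increase any degree; hence equality holds
  -- throughout.
  have hψn : ∀ i b', nilDegree (D i) (ψ b' : V) = nilDegree (D i) (b' : V) := by
    intro i
    have h1 : ∑ b', nilDegree (D i) (ψ b' : V) =
        ∑ b : ↥(B ∩ (W μ : Set V)), nilDegree (D i) (b : V) :=
      Equiv.sum_comp ψ fun b => nilDegree (D i) (b : V)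
    have h2 : ∑ b' : ↥(B' ∩ (W μ : Set V)), nilDegree (D i) (b' : V) ≤
        ∑ b : ↥(B ∩ (W μ : Set V)), nilDegree (D i) (b : V) := by
      let S := Finset.univ.filter fun b' : ↥(B' ∩ (W μ : Set V)) => 0 < nilDegree (D i) (b' : V)
      have hS : ∀ b' ∈ S, 0 < nilDegree (D i) (b' : V) := fun b' hb' => (Finset.mem_filter.1 hb').2
      calc ∑ b' : ↥(B' ∩ (W μ : Set V)), nilDegree (D i) (b' : V)
          = ∑ b' ∈ S, nilDegree (D i) (b' : V) := by
            refine (Finset.sum_subset (Finset.subset_univ _) fun b' _ hb' => ?_).symm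
            simpa [S] using hb'
        _ = ∑ b' ∈ S, nilDegree (D i) (φ i b' : V) :=
            Finset.sum_congr rfl fun b' hb' => ((hφ i b' (hS b' hb')).1).symm
        _ = ∑ b ∈ S.image (φ i), nilDegree (D i) (b : V) := by
            refine (Finset.sum_image (f := fun b : ↥(B ∩ (W μ : Set V)) => nilDegree (D i) (b : V))
              fun b' hb' c' hc' h => ?_).symm
            obtain ⟨hb1, hb2⟩ := hφ i b' (hS b' hb')
            obtain ⟨hc1, hc2⟩ := hφ i c' (hS c' hc')
            rw [h] at hb1 hb2
            rw [← hc1, hb1] at hc2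
            exact Subtype.ext (hB'.eq_of_pow_eq hnil b'.2.1 c'.2.1 rfl (hb2.symm.trans hc2))
        _ ≤ _ := Finset.sum_le_sum_of_subset (Finset.subset_univ _)
    have h3 : ∀ b' ∈ Finset.univ, nilDegree (D i) (ψ b' : V) ≤ nilDegree (D i) (b' : V) :=
      fun b' _ => hle i b' _ (hψ b')
    have h4 := (Finset.sum_eq_sum_iff_of_le h3).1
      (le_antisymm (Finset.sum_le_sum h3) (h2.trans h1.ge))
    exact fun b' => h4 b' (Finset.mem_univ _)
  intro b hb hbμ
  let b' : ↥(B' ∩ (W μ : Set V)) := ⟨b, hb, hbμ⟩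
  have hψφ : ∀ i, 0 < nilDegree (D i) b → ψ b' = φ i b' := fun i hpos => by
    by_contra hne
    exact (hrepr i b' _ hpos hne (hψ b')).ne (hψn i b')
  -- Another vector `c` in the expansion would be strictly below `ψ b'` in each degree that is
  -- nonzero at `b'`, with both degrees zero otherwise; this is what `hcomp` excludes.
  have hsupp : ∀ c, c ≠ ψ b' → β.repr (β' b') c = 0 := by
    intro c hc
    by_contra h
    refine hc (Subtype.ext (hcomp μ c c.2.1 (ψ b') (ψ b').2.1 c.2.2 (ψ b').2.2 fun i => ?_))
    by_cases hpos : 0 < nilDegree (D i) b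
    · left
      rw [hψn i b']
      exact hrepr i b' c hpos (by rwa [← hψφ i hpos]) h
    · right
      have h1 : nilDegree (D i) (b' : V) = 0 := by simpa [b'] using hpos
      rw [← hzero (hB.ne_zero c.2.1), ← hzero (hB.ne_zero (ψ b').2.1), hψn i b', h1]
      exact ⟨by simpa [h1] using hle i b' c h, rfl⟩
  have hexp : b = β.repr (β' b') (ψ b') • (ψ b' : V) := by
    have h1 := β.sum_repr (β' b')
    rw [Finset.sum_eq_single (ψ b') (fun c _ hc => by rw [hsupp c hc, zero_smul])
      (fun h => absurd (Finset.mem_univ _) h)] at h1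
    have h2 := congrArg (Subtype.val) h1
    rw [hcoe', Submodule.coe_smul, hcoe] at h2
    exact h2.symm
  -- If every operator kills `b` there is no leading coefficient to compare. Instead `ψ b' = o`, and
  -- since `o ∈ B'` the vector `b`, a multiple of `o`, is `o`.
  by_cases hall : ∀ i, D i b = 0
  · have hψo : (ψ b' : V) = o := hker _ (ψ b').2.1 fun i => by
      rw [← hzero (hB.ne_zero (ψ b').2.1), hψn i b']
      exact (hzero (hB'.ne_zero hb) i).2 (hall i)
    have : b ∈ Submodule.span ℂ {o} := by
      rw [hexp, hψo]
      exact Submodule.smul_mem _ _ (Submodule.mem_span_singleton_self _)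
    have := mem_of_mem_span_subset hB'.linearIndependent (Set.singleton_subset_iff.2 ho') hb this
    rw [Set.mem_singleton_iff.1 this, ← hψo]
    exact (ψ b').2.1
  · push Not at hall
    obtain ⟨i, hi⟩ := hall
    have hpos : 0 < nilDegree (D i) b :=
      Nat.pos_of_ne_zero fun h => hi ((hzero (hB'.ne_zero hb) i).1 h)
    have h1 := hone i b' hpos
    rw [← hψφ i hpos] at h1
    rw [hexp, h1, one_smul]
    exact (ψ b').2.1

end General

/-! ### A criterion for a family to be a perfect basis -/

section Existence

variable {V J : Type*} [AddCommGroup V] [Module ℂ V]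

/-- The family `b` is adapted to the operator `D`: up to a factorial, the highest non-vanishing
power of `D` maps members of the family to members, injectively for a given exponent. -/
structure IsAdapted (D : Module.End ℂ V) (b : J → V) (ε : J → ℕ) (τ : J → J) : Prop where
  pow_apply : ∀ j, (D ^ ε j) (b j) = ((ε j).factorial : ℂ) • b (τ j)
  apply_top : ∀ j, D (b (τ j)) = 0
  injective : ∀ j j', ε j = ε j' → τ j = τ j' → j = j'

/-! ### Kernel filtrations of adapted families -/

namespace IsAdapted

variable {D : Module.End ℂ V} {b : J → V} {ε : J → ℕ} {τ : J → J}

theorem pow_apply_of_lt (h : IsAdapted D b ε τ) {j : J} {k : ℕ} (hk : ε j < k) :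
    (D ^ k) (b j) = 0 := by
  obtain ⟨m, rfl⟩ := Nat.exists_eq_add_of_le' (Nat.succ_le_of_lt hk)
  rw [pow_add, Module.End.mul_apply, pow_succ', Module.End.mul_apply, h.pow_apply, map_smul,
    h.apply_top, smul_zero, map_zero]

theorem nilDegree_apply (h : IsAdapted D b ε τ) (hb : ∀ j, b j ≠ 0) (j : J) :
    nilDegree D (b j) = ε j := by
  refine nilDegree_eq ?_ (h.pow_apply_of_lt (Nat.lt_succ_self _))
  rw [h.pow_apply]
  exact smul_ne_zero (by exact_mod_cast (ε j).factorial_ne_zero) (hb _)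

theorem exists_mem_span (h : Submodule.span ℂ (Set.range b) = ⊤) (v : V) :
    ∃ m, v ∈ Submodule.span ℂ (b '' {j | ε j < m}) := by
  have hv : v ∈ Submodule.span ℂ (Set.range b) := by rw [h]; trivial
  have hmono : ∀ {m n : ℕ}, m ≤ n →
      Submodule.span ℂ (b '' {j | ε j < m}) ≤ Submodule.span ℂ (b '' {j | ε j < n}) :=
    fun hmn => Submodule.span_mono (Set.image_mono fun j hj => lt_of_lt_of_le hj hmn)
  induction hv using Submodule.span_induction with
  | mem x hx =>
    obtain ⟨j, rfl⟩ := hx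
    exact ⟨ε j + 1, Submodule.subset_span ⟨j, Nat.lt_succ_self _, rfl⟩⟩
  | zero => exact ⟨0, zero_mem _⟩
  | add x y _ _ hx hy =>
    obtain ⟨m, hm⟩ := hx
    obtain ⟨n, hn⟩ := hy
    exact ⟨max m n, add_mem (hmono (le_max_left _ _) hm) (hmono (le_max_right _ _) hn)⟩
  | smul a x _ hx =>
    obtain ⟨m, hm⟩ := hx
    exact ⟨m, Submodule.smul_mem _ _ hm⟩

theorem locallyNilpotent (h : IsAdapted D b ε τ) (hsp : Submodule.span ℂ (Set.range b) = ⊤)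
    (v : V) : ∃ k, (D ^ k) v = 0 := by
  obtain ⟨m, hm⟩ := exists_mem_span (ε := ε) hsp v
  refine ⟨m, LinearMap.mem_ker.1 (Submodule.span_le.2 ?_ hm)⟩
  rintro _ ⟨j, hj, rfl⟩
  exact h.pow_apply_of_lt hj

/-- On the layer of degree `m`, `D ^ m` is `m!` times a map sending basis vectors to distinct basis
vectors, so it is injective there. -/
theorem eq_zero_of_pow_eq_zero (h : IsAdapted D b ε τ) (hli : LinearIndependent ℂ b) {m : ℕ}
    {w : V} (hw : w ∈ Submodule.span ℂ (b '' {j | ε j = m})) (h0 : (D ^ m) w = 0) : w = 0 := by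
  obtain ⟨l, hl, rfl⟩ := (Finsupp.mem_span_image_iff_linearCombination ℂ).1 hw
  have hτ : LinearIndepOn ℂ (b ∘ τ) {j | ε j = m} :=
    hli.comp (fun j : {j | ε j = m} => τ j) fun j j' hj =>
      Subtype.ext (h.injective _ _ (j.2.trans j'.2.symm) hj)
  have hD : (D ^ m) (Finsupp.linearCombination ℂ b l) =
      (m.factorial : ℂ) • Finsupp.linearCombination ℂ (b ∘ τ) l := by
    rw [Finsupp.linearCombination_apply, Finsupp.linearCombination_apply, Finsupp.sum,
      Finsupp.sum, map_sum, Finset.smul_sum]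
    refine Finset.sum_congr rfl fun j hj => ?_
    have hj' : ε j = m := (Finsupp.mem_supported ℂ l).1 hl hj
    subst hj'
    rw [map_smul, h.pow_apply, smul_comm, Function.comp_apply]
  rw [hD] at h0
  have h1 := (smul_eq_zero.1 h0).resolve_left (by exact_mod_cast m.factorial_ne_zero)
  rw [linearIndepOn_iff.1 hτ l hl h1, map_zero]

theorem ker_pow_eq_span (h : IsAdapted D b ε τ) (hli : LinearIndependent ℂ b)
    (hsp : Submodule.span ℂ (Set.range b) = ⊤) (k : ℕ) :
    LinearMap.ker (D ^ k) = Submodule.span ℂ (b '' {j | ε j < k}) := by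
  refine le_antisymm (fun v hv => ?_) (Submodule.span_le.2 ?_)
  · have hstep : ∀ m, v ∈ Submodule.span ℂ (b '' {j | ε j < k + m}) →
        v ∈ Submodule.span ℂ (b '' {j | ε j < k}) := by
      intro m
      induction m with
      | zero => exact id
      | succ m ih =>
        intro hm
        have hset : {j | ε j < k + (m + 1)} = {j | ε j < k + m} ∪ {j | ε j = k + m} := by
          ext j
          simp only [Set.mem_ofPred_eq, Set.mem_union]
          omega
        rw [hset, Set.image_union, Submodule.span_union, Submodule.mem_sup] at hm
        obtain ⟨u, hu, w, hw, rfl⟩ := hm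
        have hu0 : (D ^ (k + m)) u = 0 := by
          refine LinearMap.mem_ker.1 (Submodule.span_le.2 ?_ hu)
          rintro _ ⟨j, hj, rfl⟩
          exact h.pow_apply_of_lt hj
        have hw0 : (D ^ (k + m)) w = 0 := by
          have h1 : (D ^ (k + m)) (u + w) = 0 := by
            rw [add_comm k m, pow_add, Module.End.mul_apply, LinearMap.mem_ker.1 hv, map_zero]
          rwa [map_add, hu0, zero_add] at h1
        rw [h.eq_zero_of_pow_eq_zero hli hw hw0, add_zero] at ih ⊢
        exact ih hu
    obtain ⟨m, hm⟩ := exists_mem_span (ε := ε) hsp v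
    exact hstep m (Submodule.span_mono (Set.image_mono fun j (hj : ε j < m) =>
      show ε j < k + m by omega) hm)
  · rintro _ ⟨j, hj, rfl⟩
    exact h.pow_apply_of_lt hj

/-- This supplies the vector `b'` of the perfectness axiom. Write `b (τ j) = D ^ k u`; then `u` is
killed by `D ^ (k + 1)`, so `b (τ j)` is a combination of tops of vectors of degree exactly `k`. By
linear independence it is one of them. -/
theorem exists_pred (h : IsAdapted D b ε τ) (hli : LinearIndependent ℂ b)
    (hsp : Submodule.span ℂ (Set.range b) = ⊤) (hsurj : Function.Surjective D) {j : J} {k : ℕ}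
    (hj : ε j = k + 1) : ∃ j', ε j' = k ∧ τ j' = τ j := by
  have hsurj' : Function.Surjective (D ^ k) := by
    rw [Module.End.coe_pow]
    exact hsurj.iterate k
  obtain ⟨u, hu⟩ := hsurj' (b (τ j))
  have hker : u ∈ LinearMap.ker (D ^ (k + 1)) := by
    rw [LinearMap.mem_ker, pow_succ', Module.End.mul_apply, hu, h.apply_top]
  rw [h.ker_pow_eq_span hli hsp] at hker
  have h1 : b (τ j) ∈ Submodule.span ℂ (b '' (τ '' {j' | ε j' = k})) := by
    have h2 := Submodule.mem_map_of_mem (f := D ^ k) hker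
    rw [hu, Submodule.map_span] at h2
    refine Submodule.span_le.2 ?_ h2
    rintro _ ⟨_, ⟨j', hj', rfl⟩, rfl⟩
    by_cases heq : ε j' = k
    · subst heq
      rw [h.pow_apply]
      exact Submodule.smul_mem _ _ (Submodule.subset_span ⟨_, ⟨j', rfl, rfl⟩, rfl⟩)
    · have hj' : ε j' < k + 1 := hj'
      rw [h.pow_apply_of_lt (by omega)]
      exact zero_mem _
  by_contra hcon
  refine hli.notMem_span_image ?_ h1
  rintro ⟨j', hj', hτ⟩
  exact hcon ⟨j', hj', hτ⟩

end IsAdapted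

/-- A basis of weight vectors adapted to surjective operators is perfect. -/
theorem isPerfectBasis_range {ι P : Type*} {W : P → Submodule ℂ V} {D : ι → Module.End ℂ V}
    {b : J → V} {ε : ι → J → ℕ} {τ : ι → J → J} (h : ∀ i, IsAdapted (D i) b (ε i) (τ i))
    (hli : LinearIndependent ℂ b) (hsp : Submodule.span ℂ (Set.range b) = ⊤)
    (hW : ∀ j, ∃ μ, b j ∈ W μ) (hsurj : ∀ i, Function.Surjective (D i)) :
    IsPerfectBasis W D (Set.range b) where
  linearIndependent := hli.linearIndepOn_id
  span_eq_top := hsp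
  weight := by
    rintro _ ⟨j, rfl⟩
    exact hW j
  compatible i k := by
    refine le_antisymm (Submodule.span_le.2 Set.inter_subset_right) ?_
    refine ((h i).ker_pow_eq_span hli hsp k).le.trans (Submodule.span_mono ?_)
    rintro _ ⟨j, hj, rfl⟩
    exact ⟨⟨j, rfl⟩, (h i).pow_apply_of_lt hj⟩
  perfect i := by
    rintro _ ⟨j, rfl⟩
    rw [(h i).nilDegree_apply hli.ne_zero]
    rcases hj : ε i j with _ | k
    · left
      simpa using (h i).pow_apply_of_lt (k := 1) (show ε i j < 1 by omega)
    · right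
      obtain ⟨j', hj', hτ⟩ := (h i).exists_pred hli hsp (hsurj i) hj
      refine ⟨b j', ⟨j', rfl⟩, D i (b j) - ((k + 1 : ℕ) : ℂ) • b j', ?_, by abel⟩
      have h1 := (h i).pow_apply j
      have h2 := (h i).pow_apply j'
      rw [hj, pow_succ, Module.End.mul_apply] at h1
      rw [hj'] at h2
      rw [LinearMap.mem_ker, Nat.add_sub_cancel, map_sub, map_smul, h1, h2, hτ, smul_smul,
        Nat.factorial_succ, Nat.cast_mul, sub_self]

end Existence

/-! ### Locally nilpotent derivations -/

section Derivation

variable {A : Type*} [CommRing A] [Algebra ℂ A]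

/-- A locally nilpotent derivation with a slice is surjective. -/
theorem Derivation.surjective_of_slice (D : Derivation ℂ A A)
    (hnil : ∀ f, ∃ k, ((D : Module.End ℂ A) ^ k) f = 0) {s : A} (hs : D s = 1) :
    Function.Surjective (D : Module.End ℂ A) := by
  -- Integration by parts: `(m + 1) s ^ m f = D (s ^ (m + 1) f) - s ^ (m + 1) D f`, and `D f` has
  -- smaller nilpotence order. The power of `s` grows in the recursion, so `m` must be arbitrary.
  suffices h : ∀ k f, ((D : Module.End ℂ A) ^ k) f = 0 → ∀ m : ℕ,
      s ^ m * f ∈ LinearMap.range (D : Module.End ℂ A) by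
    intro f
    obtain ⟨k, hk⟩ := hnil f
    simpa using h k f hk 0
  intro k
  induction k with
  | zero =>
    intro f hf m
    rw [pow_zero, Module.End.one_apply] at hf
    simp [hf]
  | succ k ih =>
    intro f hf m
    rw [pow_succ, Module.End.mul_apply] at hf
    have hm : ((m + 1 : ℕ) : ℂ) ≠ 0 := by exact_mod_cast m.succ_ne_zero
    rw [← Submodule.smul_mem_iff _ hm]
    have h1 : ((m + 1 : ℕ) : ℂ) • (s ^ m * f) = D (s ^ (m + 1) * f) - s ^ (m + 1) * D f := by
      rw [D.leibniz, D.leibniz_pow, hs, Nat.add_sub_cancel]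
      simp only [smul_eq_mul, nsmul_eq_mul, mul_one, Nat.cast_smul_eq_nsmul]
      ring
    rw [h1]
    exact sub_mem ⟨_, rfl⟩ (ih _ hf _)

/-- `f` has `D`-degree at most `n`, with normalized leading coefficient `g`. -/
def Derivation.HasTop (D : Derivation ℂ A A) (f : A) (n : ℕ) (g : A) : Prop :=
  ((D : Module.End ℂ A) ^ n) f = n.factorial • g ∧ D g = 0

namespace Derivation.HasTop

variable {D : Derivation ℂ A A}

/-- In the Leibniz expansion of `D ^ (n + m)` only the term distributing `n` derivatives to `f` and
`m` to `f'` survives. Pascal's rule drives the induction; if `n` or `m` is zero, one of its two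
terms is absent. -/
theorem pow_mul_apply (n m : ℕ) : ∀ {f f' g g' : A}, ((D : Module.End ℂ A) ^ n) f = g → D g = 0 →
    ((D : Module.End ℂ A) ^ m) f' = g' → D g' = 0 →
    ((D : Module.End ℂ A) ^ (n + m)) (f * f') = (n + m).choose n • (g * g') := by
  induction hN : n + m generalizing n m with
  | zero =>
    obtain ⟨rfl, rfl⟩ : n = 0 ∧ m = 0 := by omega
    rintro f f' g g' rfl - rfl -
    simp
  | succ N ih =>
    intro f f' g g' hf hg hf' hg'
    have hD : (D : Module.End ℂ A) (f * f') = f * D f' + D f * f' := by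
      rw [Derivation.coeFn_coe, D.leibniz, smul_eq_mul, smul_eq_mul, mul_comm f']
    rw [pow_succ, Module.End.mul_apply, hD, map_add]
    rcases n with _ | n
    · obtain ⟨m, rfl⟩ : ∃ k, m = k + 1 := ⟨m - 1, by omega⟩
      rw [pow_zero, Module.End.one_apply] at hf
      subst hf
      rw [hg, zero_mul, map_zero, add_zero]
      rw [ih 0 m (by omega) (f := f) (by simp) hg (f' := D f') (by rw [← hf', pow_succ]; rfl) hg']
      simp
    · rcases m with _ | m
      · rw [pow_zero, Module.End.one_apply] at hf'
        subst hf'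
        rw [hg', mul_zero, map_zero, zero_add]
        rw [ih n 0 (by omega) (f := D f) (by rw [← hf, pow_succ]; rfl) hg (f' := f') (by simp) hg']
        obtain rfl : N = n := by omega
        simp
      · rw [ih (n + 1) m (by omega) (f := f) hf hg (f' := D f') (by rw [← hf', pow_succ]; rfl) hg',
          ih n (m + 1) (by omega) (f := D f) (by rw [← hf, pow_succ]; rfl) hg (f' := f') hf' hg',
          ← add_smul, Nat.choose_succ_succ, add_comm]

theorem one : D.HasTop 1 0 1 := by simp [HasTop]

theorem mul {f f' g g' : A} {n m : ℕ} (h : D.HasTop f n g) (h' : D.HasTop f' m g') :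
    D.HasTop (f * f') (n + m) (g * g') := by
  refine ⟨?_, by rw [D.leibniz, h.2, h'.2, smul_zero, smul_zero, add_zero]⟩
  rw [pow_mul_apply n m h.1 (by rw [map_nsmul, h.2, nsmul_zero]) h'.1
    (by rw [map_nsmul, h'.2, nsmul_zero]), smul_mul_smul_comm, smul_smul, ← mul_assoc]
  have := Nat.choose_mul_factorial_mul_factorial (Nat.le_add_right n m)
  rw [Nat.add_sub_cancel_left] at this
  rw [this]

theorem pow {f g : A} {n : ℕ} (h : D.HasTop f n g) (k : ℕ) : D.HasTop (f ^ k) (k * n) (g ^ k) := by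
  induction k with
  | zero => simpa using one
  | succ k ih => simpa [pow_succ, Nat.succ_mul] using ih.mul h

theorem prod {κ : Type*} (s : Finset κ) {f g : κ → A} {n : κ → ℕ}
    (h : ∀ p, D.HasTop (f p) (n p) (g p)) :
    D.HasTop (∏ p ∈ s, f p) (∑ p ∈ s, n p) (∏ p ∈ s, g p) := by
  classical
  induction s using Finset.induction_on with
  | empty => simpa using one
  | insert p s hp ih =>
    rw [Finset.prod_insert hp, Finset.prod_insert hp, Finset.sum_insert hp]
    exact (h p).mul ih

end Derivation.HasTop

end Derivation

/-! ### Bases of polynomial rings from leading monomials -/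

section Leading

variable {σ : Type*}

/-- The span of the monomials of weight less than `n`. -/
noncomputable def lowerSpan (w : σ → ℕ) (n : ℕ) : Submodule ℂ (MvPolynomial σ ℂ) :=
  Submodule.span ℂ ((fun m => monomial m (1 : ℂ)) '' {m | Finsupp.weight w m < n})

/-- `f` is the monomial with exponent `m` plus monomials of smaller weight. -/
def HasLeading (w : σ → ℕ) (f : MvPolynomial σ ℂ) (m : σ →₀ ℕ) : Prop :=
  f - monomial m 1 ∈ lowerSpan w (Finsupp.weight w m)

theorem monomial_mem_lowerSpan {w : σ → ℕ} {m : σ →₀ ℕ} {n : ℕ} (h : Finsupp.weight w m < n) :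
    monomial m (1 : ℂ) ∈ lowerSpan w n :=
  Submodule.subset_span ⟨m, h, rfl⟩

theorem monomial_mul_mem_lowerSpan {w : σ → ℕ} {m : σ →₀ ℕ} {n : ℕ} {f : MvPolynomial σ ℂ}
    (hf : f ∈ lowerSpan w n) : monomial m 1 * f ∈ lowerSpan w (Finsupp.weight w m + n) := by
  induction hf using Submodule.span_induction with
  | mem x hx =>
    obtain ⟨m', hm', rfl⟩ := hx
    have hm' : Finsupp.weight w m' < n := hm'
    dsimp only
    rw [monomial_mul, one_mul]
    exact monomial_mem_lowerSpan (by rw [map_add]; omega)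
  | zero => simp
  | add x y _ _ hx hy => rw [mul_add]; exact add_mem hx hy
  | smul a x _ hx => rw [mul_smul_comm]; exact Submodule.smul_mem _ _ hx

theorem lowerSpan_mono {w : σ → ℕ} {n n' : ℕ} (h : n ≤ n') : lowerSpan w n ≤ lowerSpan w n' :=
  Submodule.span_mono (Set.image_mono fun _ hm => lt_of_lt_of_le hm h)

theorem mul_mem_lowerSpan {w : σ → ℕ} {n n' : ℕ} {f g : MvPolynomial σ ℂ}
    (hf : f ∈ lowerSpan w n) (hg : g ∈ lowerSpan w n') : f * g ∈ lowerSpan w (n + n') := by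
  induction hf using Submodule.span_induction with
  | mem x hx =>
    obtain ⟨m, hm, rfl⟩ := hx
    have hm : Finsupp.weight w m < n := hm
    exact lowerSpan_mono (by omega) (monomial_mul_mem_lowerSpan hg)
  | zero => simp
  | add x y _ _ hx hy => rw [add_mul]; exact add_mem hx hy
  | smul a x _ hx => rw [smul_mul_assoc]; exact Submodule.smul_mem _ _ hx

namespace HasLeading

variable {w : σ → ℕ}

theorem one : HasLeading w 1 0 := by
  rw [HasLeading, monomial_zero', C_1, sub_self]
  exact zero_mem _

theorem X (p : σ) : HasLeading w (MvPolynomial.X p) (Finsupp.single p 1) := by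
  rw [HasLeading, MvPolynomial.X, sub_self]
  exact zero_mem _

theorem mul {f g : MvPolynomial σ ℂ} {m m' : σ →₀ ℕ} (hf : HasLeading w f m)
    (hg : HasLeading w g m') : HasLeading w (f * g) (m + m') := by
  have h : f * g - monomial (m + m') 1 = (f - monomial m 1) * (g - monomial m' 1)
      + monomial m 1 * (g - monomial m' 1) + monomial m' 1 * (f - monomial m 1) := by
    rw [← mul_one (1 : ℂ), ← monomial_mul, mul_one]
    ring
  rw [HasLeading, h, map_add]
  refine add_mem (add_mem (mul_mem_lowerSpan hf hg) (monomial_mul_mem_lowerSpan hg)) ?_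
  rw [add_comm]
  exact monomial_mul_mem_lowerSpan hf

theorem pow {f : MvPolynomial σ ℂ} {m : σ →₀ ℕ} (hf : HasLeading w f m) (k : ℕ) :
    HasLeading w (f ^ k) (k • m) := by
  induction k with
  | zero => simpa using one
  | succ k ih => simpa [pow_succ, succ_nsmul] using ih.mul hf

theorem prod {κ : Type*} (s : Finset κ) {f : κ → MvPolynomial σ ℂ} {m : κ → σ →₀ ℕ}
    (h : ∀ p, HasLeading w (f p) (m p)) : HasLeading w (∏ p ∈ s, f p) (∑ p ∈ s, m p) := by
  classical
  induction s using Finset.induction_on with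
  | empty => simpa using one
  | insert p s hp ih =>
    rw [Finset.prod_insert hp, Finset.sum_insert hp]
    exact (h p).mul ih

theorem sub {f g : MvPolynomial σ ℂ} {m m' : σ →₀ ℕ} (hf : HasLeading w f m)
    (hg : HasLeading w g m') (h : Finsupp.weight w m' < Finsupp.weight w m) :
    HasLeading w (f - g) m := by
  have h' : f - g - monomial m 1 = (f - monomial m 1) - ((g - monomial m' 1) + monomial m' 1) := by
    ring
  rw [HasLeading, h']
  exact sub_mem hf (add_mem (lowerSpan_mono h.le hg) (monomial_mem_lowerSpan h))

theorem coeff_eq_zero_of_mem {n : ℕ} {f : MvPolynomial σ ℂ} (hf : f ∈ lowerSpan w n)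
    {m : σ →₀ ℕ} (hm : n ≤ Finsupp.weight w m) : coeff m f = 0 := by
  classical
  have : lowerSpan w n ≤ LinearMap.ker (lcoeff ℂ m) := by
    refine Submodule.span_le.2 ?_
    rintro _ ⟨m', hm', rfl⟩
    have hm' : Finsupp.weight w m' < n := hm'
    have hne : m' ≠ m := by
      rintro rfl
      omega
    simp [coeff_monomial, hne]
  simpa using this hf

theorem coeff_eq {f : MvPolynomial σ ℂ} {m m' : σ →₀ ℕ} (hf : HasLeading w f m)
    (h : Finsupp.weight w m ≤ Finsupp.weight w m') :
    coeff m' f = coeff m' (monomial m (1 : ℂ)) := by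
  rw [← sub_eq_zero, ← coeff_sub]
  exact coeff_eq_zero_of_mem hf h

variable {J : Type*} {b : J → MvPolynomial σ ℂ} {L : J → σ →₀ ℕ}

/-- In a relation, take an index `j` of maximal leading weight: the monomial `L j` occurs in no
other member of the support, so its coefficient in the relation is that of `b j`. -/
theorem linearIndependent (h : ∀ j, HasLeading w (b j) (L j)) (hL : Function.Injective L) :
    LinearIndependent ℂ b := by
  classical
  rw [linearIndependent_iff]
  intro l hl
  by_contra hne
  obtain ⟨j, hj, hmax⟩ := Finset.exists_max_image l.support (fun j => Finsupp.weight w (L j))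
    (Finsupp.support_nonempty_iff.2 hne)
  have h1 := congrArg (coeff (L j)) hl
  rw [Finsupp.linearCombination_apply, Finsupp.sum, coeff_sum, Finset.sum_eq_single j] at h1
  · rw [coeff_smul, (h j).coeff_eq le_rfl, coeff_monomial, if_pos rfl] at h1
    exact (Finsupp.mem_support_iff.1 hj) (by simpa using h1)
  · intro j' hj' hjj'
    rw [coeff_smul, (h j').coeff_eq (hmax j' hj'), coeff_monomial,
      if_neg fun h => hjj' (hL h), smul_zero]
  · exact fun h => absurd hj h

/-- Triangularity: each monomial is some `b j` up to monomials of smaller weight, which are treated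
by induction. -/
theorem span_eq_top (h : ∀ j, HasLeading w (b j) (L j)) (hL : Function.Surjective L) :
    Submodule.span ℂ (Set.range b) = ⊤ := by
  have hmon : ∀ n, ∀ m : σ →₀ ℕ, Finsupp.weight w m < n →
      monomial m (1 : ℂ) ∈ Submodule.span ℂ (Set.range b) := by
    intro n
    induction n with
    | zero => exact fun m hm => absurd hm (Nat.not_lt_zero _)
    | succ n ih =>
      intro m hm
      obtain ⟨j, rfl⟩ := hL m
      have h1 : lowerSpan w (Finsupp.weight w (L j)) ≤ Submodule.span ℂ (Set.range b) := by
        refine Submodule.span_le.2 ?_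
        rintro _ ⟨m', hm', rfl⟩
        exact ih m' (lt_of_lt_of_le hm' (Nat.lt_succ_iff.1 hm))
      rw [← sub_sub_cancel (b j) (monomial (L j) 1)]
      exact sub_mem (Submodule.subset_span ⟨j, rfl⟩) (h1 (h j))
  refine eq_top_iff.2 fun f _ => ?_
  rw [f.as_sum]
  refine sum_mem fun m _ => ?_
  rw [← mul_one (coeff m f), ← smul_eq_mul, ← smul_monomial]
  exact Submodule.smul_mem _ _ (hmon _ m (Nat.lt_succ_self _))

end HasLeading

end Leading

/-! ### Derivations and weights on the coordinate ring -/

section CoordRing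

variable {r : ℕ}

/-- The derivations `e_i` (left summand) and `e_i^*` (right summand). -/
noncomputable def simpleDerivation (r : ℕ) :
    Fin r ⊕ Fin r → Derivation ℂ (CoordRing r) (CoordRing r)
  | .inl i => mkDerivation ℂ fun p => (genericMatrix r * simpleRootVector r i) p.1.1 p.1.2
  | .inr i => mkDerivation ℂ fun p => (simpleRootVector r i * genericMatrix r) p.1.1 p.1.2

/-- The axioms never relate two different operators, so the two actions may be merged into a single
family. -/
theorem isBiperfectBasis_iff {B : Set (CoordRing r)} : IsBiperfectBasis r B ↔
    1 ∈ B ∧ IsPerfectBasis (weightSpace r)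
      (fun i => (simpleDerivation r i : Module.End ℂ (CoordRing r))) B := by
  constructor
  · rintro ⟨h1, hl, hr⟩
    refine ⟨h1, ⟨⟨hl.toIsWeightBasis, ?_⟩, ?_⟩⟩
    · rintro (i | i)
      exacts [hl.compatible i, hr.compatible i]
    · rintro (i | i)
      exacts [hl.perfect i, hr.perfect i]
  · rintro ⟨h1, h⟩
    exact ⟨h1, ⟨⟨h.toIsWeightBasis, fun i => h.compatible (.inl i)⟩, fun i => h.perfect (.inl i)⟩,
      ⟨⟨h.toIsWeightBasis, fun i => h.compatible (.inr i)⟩, fun i => h.perfect (.inr i)⟩⟩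

theorem genericMatrix_of_lt {j k : Fin (r + 1)} (h : j < k) :
    genericMatrix r j k = X ⟨(j, k), h⟩ := by
  simp [genericMatrix, h]

theorem genericMatrix_self (j : Fin (r + 1)) : genericMatrix r j j = 1 := by
  simp [genericMatrix]

theorem genericMatrix_of_gt {j k : Fin (r + 1)} (h : k < j) : genericMatrix r j k = 0 := by
  simp [genericMatrix, h.not_gt, h.ne']

theorem simpleDerivation_inl_genericMatrix (i : Fin r) (j k : Fin (r + 1)) :
    simpleDerivation r (.inl i) (genericMatrix r j k) =
      if k = i.succ then genericMatrix r j i.castSucc else 0 := by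
  obtain h | rfl | h := lt_trichotomy j k
  · rw [genericMatrix_of_lt h, simpleDerivation, mkDerivation_X]
    split_ifs with hk
    · subst hk
      simp [simpleRootVector]
    · simp [simpleRootVector, hk]
  · rw [genericMatrix_self, Derivation.map_one_eq_zero]
    split_ifs with hk
    · subst hk
      rw [genericMatrix_of_gt Fin.castSucc_lt_succ]
    · rfl
  · rw [genericMatrix_of_gt h, map_zero]
    split_ifs with hk
    · subst hk
      rw [genericMatrix_of_gt (Fin.castSucc_lt_succ.trans h)]
    · rfl

theorem simpleDerivation_inr_genericMatrix (i : Fin r) (j k : Fin (r + 1)) :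
    simpleDerivation r (.inr i) (genericMatrix r j k) =
      if j = i.castSucc then genericMatrix r i.succ k else 0 := by
  obtain h | rfl | h := lt_trichotomy j k
  · rw [genericMatrix_of_lt h, simpleDerivation, mkDerivation_X]
    split_ifs with hk
    · subst hk
      simp [simpleRootVector]
    · simp [simpleRootVector, hk]
  · rw [genericMatrix_self, Derivation.map_one_eq_zero]
    split_ifs with hk
    · subst hk
      rw [genericMatrix_of_gt Fin.castSucc_lt_succ]
    · rfl
  · rw [genericMatrix_of_gt h, map_zero]
    split_ifs with hk
    · subst hk
      rw [genericMatrix_of_gt (h.trans Fin.castSucc_lt_succ)]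
    · rfl

theorem exists_simpleDerivation_eq_one (i : Fin r ⊕ Fin r) :
    ∃ s, simpleDerivation r i s = 1 := by
  obtain i | i := i
  · exact ⟨genericMatrix r i.castSucc i.succ, by
      rw [simpleDerivation_inl_genericMatrix, if_pos rfl, genericMatrix_self]⟩
  · exact ⟨genericMatrix r i.castSucc i.succ, by
      rw [simpleDerivation_inr_genericMatrix, if_pos rfl, genericMatrix_self]⟩

theorem isWeightedHomogeneous_genericMatrix (j k : Fin (r + 1)) :
    IsWeightedHomogeneous (entryWeight r) (genericMatrix r j k)
      (Pi.single k 1 - Pi.single j 1) := by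
  obtain h | rfl | h := lt_trichotomy j k
  · rw [genericMatrix_of_lt h]
    exact isWeightedHomogeneous_X ℂ (entryWeight r) ⟨(j, k), h⟩
  · rw [genericMatrix_self, sub_self]
    exact isWeightedHomogeneous_one ℂ _
  · rw [genericMatrix_of_gt h]
    exact isWeightedHomogeneous_zero ℂ _ _

/-- The simple root as a weight of `ℂ[N]`. -/
def simpleRootWeight (r : ℕ) (i : Fin r) : Fin (r + 1) → ℤ :=
  Pi.single i.succ 1 - Pi.single i.castSucc 1

theorem isWeightedHomogeneous_mkDerivation {σ M : Type*} [AddCommGroup M] {w : σ → M} {α μ : M}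
    {g : σ → MvPolynomial σ ℂ} (hg : ∀ p, IsWeightedHomogeneous w (g p) (w p - α))
    {f : MvPolynomial σ ℂ} (hf : IsWeightedHomogeneous w f μ) :
    IsWeightedHomogeneous w (mkDerivation ℂ g f) (μ - α) := by
  classical
  rw [f.as_sum, map_sum]
  refine IsWeightedHomogeneous.sum _ _ _ fun s hs => ?_
  rw [mkDerivation_monomial, smul_eq_C_mul]
  refine IsWeightedHomogeneous.C_mul ?_ _
  refine IsWeightedHomogeneous.sum _ _ _ fun p hp => ?_
  dsimp only
  rw [smul_eq_mul]
  have h1 : s - Finsupp.single p 1 + Finsupp.single p 1 = s :=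
    tsub_add_cancel_of_le (by
      rw [Finsupp.single_le_iff]
      exact Nat.one_le_iff_ne_zero.2 (Finsupp.mem_support_iff.1 hp))
  have h2 : Finsupp.weight w (s - Finsupp.single p 1) + w p = μ := by
    have h3 := hf (mem_support_iff.1 hs)
    rw [← h1, map_add, Finsupp.weight_single, one_smul] at h3
    exact h3
  have h3 := (isWeightedHomogeneous_monomial w (s - Finsupp.single p 1) ((s p : ℕ) : ℂ) rfl).mul
    (hg p)
  rwa [show Finsupp.weight w (s - Finsupp.single p 1) + (w p - α) = μ - α by
    rw [← h2]; abel] at h3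

theorem simpleDerivation_mem_weightSpace (i : Fin r ⊕ Fin r) {μ : Fin (r + 1) → ℤ}
    {f : CoordRing r} (hf : f ∈ weightSpace r μ) :
    simpleDerivation r i f ∈ weightSpace r (μ - simpleRootWeight r (i.elim id id)) := by
  obtain i | i := i
  · refine isWeightedHomogeneous_mkDerivation (fun p => ?_) hf
    have h := simpleDerivation_inl_genericMatrix i p.1.1 p.1.2
    rw [genericMatrix_of_lt p.2, simpleDerivation, mkDerivation_X] at h
    dsimp only at h
    rw [h]
    split_ifs with hp
    · have h1 : entryWeight r p - simpleRootWeight r i =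
          Pi.single i.castSucc 1 - Pi.single p.1.1 1 := by
        rw [entryWeight, simpleRootWeight, hp]
        abel
      exact h1 ▸ isWeightedHomogeneous_genericMatrix p.1.1 i.castSucc
    · exact isWeightedHomogeneous_zero ℂ _ _
  · refine isWeightedHomogeneous_mkDerivation (fun p => ?_) hf
    have h := simpleDerivation_inr_genericMatrix i p.1.1 p.1.2
    rw [genericMatrix_of_lt p.2, simpleDerivation, mkDerivation_X] at h
    dsimp only at h
    rw [h]
    split_ifs with hp
    · have h1 : entryWeight r p - simpleRootWeight r i =
          Pi.single p.1.2 1 - Pi.single i.succ 1 := by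
        rw [entryWeight, simpleRootWeight, hp]
        abel
      exact h1 ▸ isWeightedHomogeneous_genericMatrix i.succ p.1.2
    · exact isWeightedHomogeneous_zero ℂ _ _

/-- The height of a weight of `ℂ[N]`. -/
def weightHeight (r : ℕ) : (Fin (r + 1) → ℤ) →+ ℤ where
  toFun μ := ∑ j : Fin (r + 1), (j : ℤ) * μ j
  map_zero' := by simp
  map_add' μ ν := by simp [mul_add, Finset.sum_add_distrib]

theorem weightHeight_single (j : Fin (r + 1)) : weightHeight r (Pi.single j 1) = (j : ℤ) := by
  simp [weightHeight, Pi.single_apply]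

/-- The height of a positive root. -/
def rootHeight (r : ℕ) (p : PosRoot r) : ℕ := p.1.2 - p.1.1

theorem weightHeight_weight (m : PosRoot r →₀ ℕ) :
    weightHeight r (Finsupp.weight (entryWeight r) m) = (Finsupp.weight (rootHeight r) m : ℕ) := by
  induction m using Finsupp.induction_linear with
  | zero => simp
  | add m m' h h' => simp [h, h']
  | single p n =>
    have : (p.1.1 : ℕ) < p.1.2 := p.2
    rw [Finsupp.weight_single, Finsupp.weight_single, map_nsmul, entryWeight, map_sub,
      weightHeight_single, weightHeight_single, rootHeight, smul_eq_mul, nsmul_eq_mul,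
      Nat.cast_mul, Nat.cast_sub this.le]

theorem exists_weightHeight_eq {μ : Fin (r + 1) → ℤ} {f : CoordRing r} (hf : f ∈ weightSpace r μ)
    (h0 : f ≠ 0) : ∃ n : ℕ, weightHeight r μ = n := by
  obtain ⟨m, hm⟩ := MvPolynomial.ne_zero_iff.1 h0
  exact ⟨_, by rw [← hf hm, weightHeight_weight]⟩

/-- The weight fixes the total root height of a monomial, and every variable has positive root
height. -/
theorem finiteDimensional_weightSpace (μ : Fin (r + 1) → ℤ) :
    FiniteDimensional ℂ (weightSpace r μ) := by
  have hle : weightSpace r μ ≤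
      weightedHomogeneousSubmodule ℂ (rootHeight r) (weightHeight r μ).toNat := by
    intro f hf m hm
    have h := weightHeight_weight m
    rw [hf hm] at h
    omega
  have : FiniteDimensional ℂ
      (weightedHomogeneousSubmodule ℂ (rootHeight r) (weightHeight r μ).toNat) :=
    Module.Finite.iff_fg.2 (weightedHomogeneousSubmodule_fg ℂ _ (fun p => by
      have : (p.1.1 : ℕ) < p.1.2 := p.2
      simp only [rootHeight]
      omega) _)
  exact Submodule.finiteDimensional_of_le hle

theorem isLoweringFamily_simpleDerivation
    (hnil : ∀ i f, ∃ k, ((simpleDerivation r i : Module.End ℂ (CoordRing r)) ^ k) f = 0) :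
    IsLoweringFamily (weightSpace r)
      (fun i => (simpleDerivation r i : Module.End ℂ (CoordRing r)))
      (fun μ => (weightHeight r μ).toNat) where
  exists_proj μ := ⟨weightedHomogeneousComponent (entryWeight r) μ,
    fun _ hv => IsWeightedHomogeneous.weightedHomogeneousComponent_same hv,
    fun _ hν _ hv => IsWeightedHomogeneous.weightedHomogeneousComponent_ne μ hv hν.symm⟩
  finite := finiteDimensional_weightSpace
  lower i μ f hf h0 := by
    refine ⟨_, ?_, simpleDerivation_mem_weightSpace i hf⟩
    -- As the derivative is nonzero, its weight has height `n ≥ 0`, so `toNat` truncates neither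
    -- height.
    obtain ⟨n, hn⟩ := exists_weightHeight_eq (simpleDerivation_mem_weightSpace i hf) h0
    have h1 : weightHeight r (simpleRootWeight r (i.elim id id)) = 1 := by
      rw [simpleRootWeight, map_sub, weightHeight_single, weightHeight_single]
      simp
    rw [map_sub, h1] at hn
    rw [map_sub, h1]
    omega
  nilpotent := hnil

/-- A combinatorial model of a biperfect basis: a family of polynomials indexed by `J`, with
bijective leading exponents `L`, whose nilpotence degrees `ε` and normalized top derivatives `τ`
separate its members. Such a family is the unique biperfect basis. -/
theorem biperfectBasis_of_model {J : Type*} {b : J → CoordRing r} {μ : J → Fin (r + 1) → ℤ}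
    {w : PosRoot r → ℕ} {L : J → PosRoot r →₀ ℕ} {ε : Fin r ⊕ Fin r → J → ℕ}
    {τ : Fin r ⊕ Fin r → J → J} {o : J}
    (hμ : ∀ j, IsWeightedHomogeneous (entryWeight r) (b j) (μ j))
    (hlead : ∀ j, HasLeading w (b j) (L j)) (hL : Function.Bijective L)
    (htop : ∀ i j, (simpleDerivation r i).HasTop (b j) (ε i j) (b (τ i j)))
    (hinj : ∀ i j j', ε i j = ε i j' → τ i j = τ i j' → j = j')
    (hone : b o = 1) (hker : ∀ j, (∀ i, ε i j = 0) → j = o)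
    (hcomp : ∀ j j', μ j = μ j' →
      (∀ i, ε i j < ε i j' ∨ ε i j = 0 ∧ ε i j' = 0) → j = j') :
    IsBiperfectBasis r (Set.range b) ∧ ∀ B, IsBiperfectBasis r B → B = Set.range b := by
  have hli := HasLeading.linearIndependent hlead hL.1
  have hsp := HasLeading.span_eq_top hlead hL.2
  have hada : ∀ i, IsAdapted (simpleDerivation r i : Module.End ℂ (CoordRing r)) b (ε i) (τ i) :=
    fun i => ⟨fun j => by rw [(htop i j).1, Nat.cast_smul_eq_nsmul], fun j => (htop i j).2,
      hinj i⟩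
  have hnil := fun i => (hada i).locallyNilpotent hsp
  have hsurj : ∀ i, Function.Surjective (simpleDerivation r i : Module.End ℂ (CoordRing r)) :=
    fun i => by
      obtain ⟨s, hs⟩ := exists_simpleDerivation_eq_one i
      exact (simpleDerivation r i).surjective_of_slice (hnil i) hs
  have hperf := isPerfectBasis_range (W := weightSpace r) hada hli hsp (fun j => ⟨μ j, hμ j⟩) hsurj
  have hdeg := fun i => (hada i).nilDegree_apply hli.ne_zero
  have hzero : ∀ i j, simpleDerivation r i (b j) = 0 → ε i j = 0 := by
    intro i j h
    rw [← hdeg i j]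
    have := (pow_apply_eq_zero_iff (hnil i (b j)) (hli.ne_zero j) (k := 1)).1 (by simpa using h)
    omega
  refine ⟨isBiperfectBasis_iff.2 ⟨⟨o, hone⟩, hperf⟩, fun B hB => ?_⟩
  obtain ⟨h1, hB⟩ := isBiperfectBasis_iff.1 hB
  refine (isLoweringFamily_simpleDerivation hnil).perfectBasis_unique hperf hB h1 ?_ ?_
  · rintro _ ⟨j, rfl⟩ h
    rw [hker j fun i => hzero i j (h i), hone]
  · rintro ν _ ⟨j, rfl⟩ _ ⟨j', rfl⟩ hj hj' h
    have hμj := (hμ j).inj_right (hli.ne_zero j) hj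
    have hμj' := (hμ j').inj_right (hli.ne_zero j') hj'
    rw [hcomp j j' (hμj.trans hμj'.symm) fun i => ?_]
    obtain h | ⟨h, h'⟩ := h i
    · rw [hdeg, hdeg] at h
      exact Or.inl h
    · exact Or.inr ⟨hzero i j h, hzero i j' h'⟩

end CoordRing

/-! ### Combinatorics of the case of `SL_4` -/

/-- Exponents of monomials in the twelve irreducible minors of a unitriangular matrix of size four.
The fields `a`, `d`, `e`, `f`, `p`, `q` stand for the minors with rows and columns
`(12, 23)`, `(12, 24)`, `(13, 34)`, `(23, 34)`, `(12, 34)`, `(123, 234)`. -/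
@[ext]
structure SL4Exponent where
  (x12 x13 x14 x23 x24 x34 a d e f p q : ℕ)

namespace SL4Exponent

/-- The monomial involves no two crossing minors. -/
structure Noncrossing (c : SL4Exponent) : Prop where
  x12_x23 : c.x12 = 0 ∨ c.x23 = 0
  x23_x34 : c.x23 = 0 ∨ c.x34 = 0
  x12_x24 : c.x12 = 0 ∨ c.x24 = 0
  x13_x34 : c.x13 = 0 ∨ c.x34 = 0
  x13_x24 : c.x13 = 0 ∨ c.x24 = 0
  x12_f : c.x12 = 0 ∨ c.f = 0
  x34_a : c.x34 = 0 ∨ c.a = 0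
  x23_d : c.x23 = 0 ∨ c.d = 0
  x23_e : c.x23 = 0 ∨ c.e = 0
  x13_d : c.x13 = 0 ∨ c.d = 0
  x24_e : c.x24 = 0 ∨ c.e = 0
  a_f : c.a = 0 ∨ c.f = 0
  a_e : c.a = 0 ∨ c.e = 0
  d_f : c.d = 0 ∨ c.f = 0
  d_e : c.d = 0 ∨ c.e = 0

/-- The nilpotence degrees with respect to the simple derivations. -/
def degree (c : SL4Exponent) : Fin 3 ⊕ Fin 3 → ℕ :=
  Sum.elim ![c.x12 + c.a + c.d + c.q, c.x13 + c.x23 + c.e + c.f + c.p, c.x14 + c.x24 + c.x34 + c.d]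
    ![c.x12 + c.x13 + c.x14 + c.e, c.x23 + c.x24 + c.a + c.d + c.p, c.x34 + c.e + c.f + c.q]

/-- The exponents of the normalized top derivatives with respect to the simple derivations. -/
def top (c : SL4Exponent) : Fin 3 ⊕ Fin 3 → SL4Exponent :=
  Sum.elim
    ![⟨0, c.x13, c.x14, c.x23 + c.a, c.x24 + c.d, c.x34, 0, 0, c.e, c.f + c.q, c.p, 0⟩,
      ⟨c.x12 + c.x13 + c.e, 0, c.x14, 0, c.x24, c.x34 + c.e + c.f, c.a, c.d + c.p, 0, 0, 0, c.q⟩,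
      ⟨c.x12, c.x13 + c.x14, 0, c.x23 + c.x24, 0, 0, c.a + c.d, 0, c.e, c.f, c.p, c.q⟩]
    ![⟨0, 0, 0, c.x23 + c.x13, c.x24 + c.x14, c.x34, c.a, c.d, 0, c.f + c.e, c.p, c.q⟩,
      ⟨c.x12 + c.a + c.d, c.x13, c.x14, 0, 0, c.x34 + c.x24 + c.d, 0, 0, c.e + c.p, c.f, 0, c.q⟩,
      ⟨c.x12, c.x13 + c.e, c.x14, c.x23 + c.f, c.x24, 0, c.a + c.q, c.d, 0, 0, c.p, 0⟩]

theorem Noncrossing.top {c : SL4Exponent} (h : c.Noncrossing) (i : Fin 3 ⊕ Fin 3) :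
    (c.top i).Noncrossing := by
  obtain ⟨h1, h2, h3, h4, h5, h6, h7, h8, h9, h10, h11, h12, h13, h14, h15⟩ := h
  obtain i | i := i <;> fin_cases i <;> constructor <;> simp [SL4Exponent.top] <;> grind

set_option maxHeartbeats 4000000 in
-- Taking tops merges certain exponents into sums. Since crossing exponents cannot both be nonzero,
-- each lost exponent is recovered from these sums and the degree by minima; the remaining exponents
-- follow linearly.
theorem Noncrossing.eq_of_top_eq {c c' : SL4Exponent} (h : c.Noncrossing) (h' : c'.Noncrossing)
    (i : Fin 3 ⊕ Fin 3) (hd : c.degree i = c'.degree i) (ht : c.top i = c'.top i) : c = c' := by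
  obtain i | i := i <;> fin_cases i <;> simp [SL4Exponent.top, degree] at ht hd
  · have key : ∀ {c : SL4Exponent}, c.Noncrossing →
        c.q = min (c.f + c.q) (c.x12 + c.a + c.d + c.q) ∧
        c.a = min (c.x23 + c.a) (c.x12 + c.a + c.d) ∧ c.d = min (c.x24 + c.d) (c.x12 + c.d) := by
      rintro c ⟨h1, h2, h3, h4, h5, h6, h7, h8, h9, h10, h11, h12, h13, h14, h15⟩
      clear h2 h4 h5 h7 h9 h10 h11 h13 h15
      grind
    obtain ⟨k1, k2, k3⟩ := key h
    obtain ⟨l1, l2, l3⟩ := key h'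
    have m1 : c.q = c'.q := by rw [k1, l1]; congr 1; omega
    have m2 : c.a = c'.a := by rw [k2, l2]; congr 1 <;> omega
    have m3 : c.d = c'.d := by rw [k3, l3]; congr 1 <;> omega
    clear k1 l1 k2 l2 k3 l3
    ext <;> omega
  · have key : ∀ {c : SL4Exponent}, c.Noncrossing →
        c.p = min (c.d + c.p) (c.x13 + c.x23 + c.e + c.f + c.p) ∧
        -- The truncation of the subtractions is essential here: it encodes that `x23` crosses
        -- `x12`, `x34` and `e`.
        c.x23 = (c.x13 + c.x23 + c.e + c.f) - (c.x12 + c.x13 + c.e) - (c.x34 + c.e + c.f) ∧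
        c.x13 = min (c.x12 + c.x13 + c.e) (c.x13 + c.x23 + c.e + c.f - (c.x34 + c.e + c.f)) ∧
        c.f = min (c.x34 + c.e + c.f) (c.x13 + c.x23 + c.e + c.f - (c.x12 + c.x13 + c.e)) := by
      rintro c ⟨h1, h2, h3, h4, h5, h6, h7, h8, h9, h10, h11, h12, h13, h14, h15⟩
      clear h3 h5 h7 h11 h12 h13
      refine ⟨?_, ?_, ?_, ?_⟩ <;> grind
    obtain ⟨k1, k2, k3, k4⟩ := key h
    obtain ⟨l1, l2, l3, l4⟩ := key h'
    have m1 : c.p = c'.p := by rw [k1, l1]; congr 1; omega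
    have m2 : c.x23 = c'.x23 := by rw [k2, l2]; congr 1 <;> omega
    have m3 : c.x13 = c'.x13 := by rw [k3, l3]; congr 1 <;> omega
    have m4 : c.f = c'.f := by rw [k4, l4]; congr 1 <;> omega
    clear k1 l1 k2 l2 k3 l3 k4 l4
    ext <;> omega
  · have key : ∀ {c : SL4Exponent}, c.Noncrossing →
        c.x14 = min (c.x13 + c.x14) (c.x14 + c.x24 + c.x34 + c.d) ∧
        c.x24 = min (c.x23 + c.x24) (c.x24 + c.x34 + c.d) ∧
        c.d = min (c.a + c.d) (c.x34 + c.d) := by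
      rintro c ⟨h1, h2, h3, h4, h5, h6, h7, h8, h9, h10, h11, h12, h13, h14, h15⟩
      clear h1 h3 h6 h9 h11 h12 h13 h14 h15
      grind
    obtain ⟨k1, k2, k3⟩ := key h
    obtain ⟨l1, l2, l3⟩ := key h'
    have m1 : c.x14 = c'.x14 := by rw [k1, l1]; congr 1; omega
    have m2 : c.x24 = c'.x24 := by rw [k2, l2]; congr 1 <;> omega
    have m3 : c.d = c'.d := by rw [k3, l3]; congr 1 <;> omega
    clear k1 l1 k2 l2 k3 l3
    ext <;> omega
  · have key : ∀ {c : SL4Exponent}, c.Noncrossing →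
        c.x14 = min (c.x24 + c.x14) (c.x12 + c.x13 + c.x14 + c.e) ∧
        c.x13 = min (c.x23 + c.x13) (c.x12 + c.x13 + c.e) ∧
        c.e = min (c.f + c.e) (c.x12 + c.e) := by
      rintro c ⟨h1, h2, h3, h4, h5, h6, h7, h8, h9, h10, h11, h12, h13, h14, h15⟩
      clear h2 h4 h7 h8 h10 h12 h13 h14 h15
      grind
    obtain ⟨k1, k2, k3⟩ := key h
    obtain ⟨l1, l2, l3⟩ := key h'
    have m1 : c.x14 = c'.x14 := by rw [k1, l1]; congr 1; omega
    have m2 : c.x13 = c'.x13 := by rw [k2, l2]; congr 1 <;> omega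
    have m3 : c.e = c'.e := by rw [k3, l3]; congr 1 <;> omega
    clear k1 l1 k2 l2 k3 l3
    ext <;> omega
  · have key : ∀ {c : SL4Exponent}, c.Noncrossing →
        c.p = min (c.e + c.p) (c.x23 + c.x24 + c.a + c.d + c.p) ∧
        c.x23 = (c.x23 + c.x24 + c.a + c.d) - (c.x34 + c.x24 + c.d) - (c.x12 + c.a + c.d) ∧
        c.x24 = min (c.x34 + c.x24 + c.d) (c.x23 + c.x24 + c.a + c.d - (c.x12 + c.a + c.d)) ∧
        c.a = min (c.x12 + c.a + c.d) (c.x23 + c.x24 + c.a + c.d - (c.x34 + c.x24 + c.d)) := by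
      rintro c ⟨h1, h2, h3, h4, h5, h6, h7, h8, h9, h10, h11, h12, h13, h14, h15⟩
      clear h4 h5 h6 h10 h12 h14
      refine ⟨?_, ?_, ?_, ?_⟩ <;> grind
    obtain ⟨k1, k2, k3, k4⟩ := key h
    obtain ⟨l1, l2, l3, l4⟩ := key h'
    have m1 : c.p = c'.p := by rw [k1, l1]; congr 1; omega
    have m2 : c.x23 = c'.x23 := by rw [k2, l2]; congr 1 <;> omega
    have m3 : c.x24 = c'.x24 := by rw [k3, l3]; congr 1 <;> omega
    have m4 : c.a = c'.a := by rw [k4, l4]; congr 1 <;> omega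
    clear k1 l1 k2 l2 k3 l3 k4 l4
    ext <;> omega
  · have key : ∀ {c : SL4Exponent}, c.Noncrossing →
        c.q = min (c.a + c.q) (c.x34 + c.e + c.f + c.q) ∧
        c.f = min (c.x23 + c.f) (c.x34 + c.e + c.f) ∧ c.e = min (c.x13 + c.e) (c.x34 + c.e) := by
      rintro c ⟨h1, h2, h3, h4, h5, h6, h7, h8, h9, h10, h11, h12, h13, h14, h15⟩
      clear h1 h3 h5 h6 h8 h10 h11 h14 h15
      grind
    obtain ⟨k1, k2, k3⟩ := key h
    obtain ⟨l1, l2, l3⟩ := key h'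
    have m1 : c.q = c'.q := by rw [k1, l1]; congr 1; omega
    have m2 : c.f = c'.f := by rw [k2, l2]; congr 1 <;> omega
    have m3 : c.e = c'.e := by rw [k3, l3]; congr 1 <;> omega
    clear k1 l1 k2 l2 k3 l3
    ext <;> omega

/-- Coefficients of the simple roots in the weight of the monomial. -/
def rootCoeff (c : SL4Exponent) : Fin 3 → ℕ :=
  ![c.x12 + c.x13 + c.x14 + c.a + c.d + c.e + c.p + c.q,
    c.x13 + c.x14 + c.x23 + c.x24 + c.a + c.d + c.e + c.f + 2 * c.p + c.q,
    c.x14 + c.x24 + c.x34 + c.d + c.e + c.f + c.p + c.q]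

/-- Distinct noncrossing monomials of the same weight are not strictly comparable. -/
theorem Noncrossing.eq_of_degree_lt {c c' : SL4Exponent} (h : c'.Noncrossing)
    (hw : c.rootCoeff = c'.rootCoeff)
    (hd : ∀ i, c.degree i < c'.degree i ∨ c.degree i = 0 ∧ c'.degree i = 0) : c = c' := by
  obtain ⟨w1, w2, w3⟩ : c.rootCoeff 0 = c'.rootCoeff 0 ∧ c.rootCoeff 1 = c'.rootCoeff 1 ∧
    c.rootCoeff 2 = c'.rootCoeff 2 := by simp [hw]
  have e1 := hd (.inl 0)
  have e2 := hd (.inl 1)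
  have e3 := hd (.inl 2)
  have e4 := hd (.inr 0)
  have e5 := hd (.inr 1)
  have e6 := hd (.inr 2)
  clear hd hw
  simp [degree, rootCoeff] at e1 e2 e3 e4 e5 e6 w1 w2 w3
  have l1 : c.x12 + c.a + c.d + c.q ≤ c'.x12 + c'.a + c'.d + c'.q := by omega
  have l2 : c.x13 + c.x23 + c.e + c.f + c.p ≤ c'.x13 + c'.x23 + c'.e + c'.f + c'.p := by omega
  have l3 : c.x14 + c.x24 + c.x34 + c.d ≤ c'.x14 + c'.x24 + c'.x34 + c'.d := by omega
  have l4 : c.x12 + c.x13 + c.x14 + c.e ≤ c'.x12 + c'.x13 + c'.x14 + c'.e := by omega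
  have l5 : c.x23 + c.x24 + c.a + c.d + c.p ≤ c'.x23 + c'.x24 + c'.a + c'.d + c'.p := by omega
  have l6 : c.x34 + c.e + c.f + c.q ≤ c'.x34 + c'.e + c'.f + c'.q := by omega
  -- Write `ε_i`, `ε_i^*` for the six degrees and `w_i` for the root coefficients, numbered from 1.
  -- Identically `ε_1 + ε_1^* - 2 w_1 + w_2 = x23 + x24 + f`. If `x12` occurs in `c'`, this vanishes
  -- at `c'` and is strictly smaller at `c`, hence negative, which is absurd. For `x34` the same
  -- holds with `ε_3 + ε_3^* - 2 w_3 + w_2 = x13 + x23 + a`, and for `x23` with `ε_2 + ε_2^* - 2 w_2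
  -- + w_1 + w_3 = x12 + x34 + d + e`.
  have hx12 : c'.x12 ≤ c.x12 := by
    by_contra hlt
    have h1 := h.x12_x23.resolve_left (by omega)
    have h2 := h.x12_x24.resolve_left (by omega)
    have h3 := h.x12_f.resolve_left (by omega)
    clear e2 e3 e4 e5 e6
    omega
  have hx34 : c'.x34 ≤ c.x34 := by
    by_contra hlt
    have h1 := h.x23_x34.resolve_right (by omega)
    have h2 := h.x13_x34.resolve_right (by omega)
    have h3 := h.x34_a.resolve_left (by omega)
    clear e1 e2 e4 e5 e6
    omega
  have hx23 : c'.x23 ≤ c.x23 := by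
    by_contra hlt
    have h1 := h.x23_d.resolve_left (by omega)
    have h2 := h.x23_e.resolve_left (by omega)
    clear e1 e3 e4 e5 e6
    omega
  -- Here the identity is `ε_1 + ε_2 + ε_1^* - w_1 = x12 + x13 + x23 + e + f`; for `e` below it is
  -- `ε_3 + ε_2^* + ε_3^* - w_3 = x23 + x24 + x34 + a + d`.
  have hd : c'.d ≤ c.d := by
    by_contra hlt
    have h1 := h.x13_d.resolve_right (by omega)
    have h2 := h.d_f.resolve_left (by omega)
    have h3 := h.d_e.resolve_left (by omega)
    clear e2 e3 e4 e5 e6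
    omega
  have he : c'.e ≤ c.e := by
    by_contra hlt
    have h1 := h.x24_e.resolve_right (by omega)
    have h2 := h.a_e.resolve_right (by omega)
    have h3 := h.d_e.resolve_right (by omega)
    clear e1 e2 e3 e4 e5
    omega
  -- By the bounds obtained, `x12 + x34 + d + e` at `c'` is at most its value at `c`, so neither
  -- `ε_2` nor `ε_2^*` can increase strictly and both vanish. Then `ε_1` and `ε_3` vanish at `c'` by
  -- the first two identities. So `c'` is trivial, and equality of weights makes `c` trivial.
  have e2 : c'.x13 = 0 ∧ c'.x23 = 0 ∧ c'.e = 0 ∧ c'.f = 0 ∧ c'.p = 0 := by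
    clear e1 e3 e4 e5 e6
    omega
  have e5 : c'.x24 = 0 ∧ c'.a = 0 ∧ c'.d = 0 := by
    clear e1 e2 e3 e4 e6
    omega
  have e1 : c'.x12 = 0 ∧ c'.q = 0 := by
    clear e3 e4 e6
    omega
  have e3 : c'.x14 = 0 ∧ c'.x34 = 0 := by
    clear e4 e6
    omega
  clear e4 e6
  ext <;> omega

/-- Exponents of the matrix entries `x12`, `x13`, `x14`, `x23`, `x24`, `x34` in the leading
monomial. -/
def leading (c : SL4Exponent) : Fin 6 → ℕ :=
  ![c.x12 + c.a + c.d + c.q, c.x13 + c.e + c.p, c.x14, c.x23 + c.a + c.f + c.q, c.x24 + c.d + c.p,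
    c.x34 + c.e + c.f + c.q]

/-- The exponents are recovered greedily as minima: first `p` and `q`, then `a` and `f`, then `e`
and `d`. -/
theorem Noncrossing.eq_of_leading_eq {c c' : SL4Exponent} (h : c.Noncrossing) (h' : c'.Noncrossing)
    (hl : c.leading = c'.leading) : c = c' := by
  have n12 := congrFun hl 0
  have n13 := congrFun hl 1
  have n14 := congrFun hl 2
  have n23 := congrFun hl 3
  have n24 := congrFun hl 4
  have n34 := congrFun hl 5
  simp [leading] at n12 n13 n14 n23 n24 n34
  have key : ∀ {c : SL4Exponent}, c.Noncrossing →
      c.p = min (c.x13 + c.e + c.p) (c.x24 + c.d + c.p) ∧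
      c.q = min (c.x12 + c.a + c.d + c.q)
        (min (c.x23 + c.a + c.f + c.q) (c.x34 + c.e + c.f + c.q)) ∧
      c.a = min (c.x12 + c.a + c.d) (c.x23 + c.a + c.f) ∧
      c.f = min (c.x23 + c.a + c.f) (c.x34 + c.e + c.f) ∧
      c.e = min (c.x13 + c.e) (c.x34 + c.e) ∧ c.d = min (c.x24 + c.d) (c.x12 + c.d) := by
    rintro c ⟨h1, h2, h3, h4, h5, h6, h7, h8, h9, h10, h11, h12, h13, h14, h15⟩
    refine ⟨?_, ?_, ?_, ?_, ?_, ?_⟩ <;> grind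
  obtain ⟨k1, k2, k3, k4, k5, k6⟩ := key h
  obtain ⟨l1, l2, l3, l4, l5, l6⟩ := key h'
  have m1 : c.p = c'.p := by rw [k1, l1]; congr 1
  have m2 : c.q = c'.q := by rw [k2, l2]; congr 1; congr 1
  have m3 : c.a = c'.a := by rw [k3, l3]; congr 1 <;> omega
  have m4 : c.f = c'.f := by rw [k4, l4]; congr 1 <;> omega
  have m5 : c.e = c'.e := by rw [k5, l5]; congr 1 <;> omega
  have m6 : c.d = c'.d := by rw [k6, l6]; congr 1 <;> omega
  clear k1 k2 k3 k4 k5 k6 l1 l2 l3 l4 l5 l6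
  ext <;> omega

theorem exists_leading_eq (n : Fin 6 → ℕ) : ∃ c : SL4Exponent, c.Noncrossing ∧ c.leading = n := by
  obtain ⟨p, n13, n24, h1, h4, hp⟩ : ∃ p n13 n24, n 1 = n13 + p ∧ n 4 = n24 + p ∧
    (n13 = 0 ∨ n24 = 0) := ⟨min (n 1) (n 4), n 1 - min (n 1) (n 4), n 4 - min (n 1) (n 4), by omega⟩
  obtain ⟨q, n12, n23, n34, h0, h3, h5, hq⟩ : ∃ q n12 n23 n34, n 0 = n12 + q ∧ n 3 = n23 + q ∧
      n 5 = n34 + q ∧ (n12 = 0 ∨ n23 = 0 ∨ n34 = 0) := by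
    obtain ⟨q, hq⟩ : ∃ q, q = min (n 0) (min (n 3) (n 5)) := ⟨_, rfl⟩
    exact ⟨q, n 0 - q, n 3 - q, n 5 - q, by omega⟩
  -- After `q` has been split off, one of `n12`, `n23`, `n34` is zero, so `a` and `f` are not both
  -- nonzero. The factors `e` and `d` use what remains of `n34` and `n12`.
  obtain ⟨a, ha⟩ : ∃ a, a = min n12 n23 := ⟨_, rfl⟩
  obtain ⟨f, hf⟩ : ∃ f, f = min n23 n34 := ⟨_, rfl⟩
  obtain ⟨e, he⟩ : ∃ e, e = min n13 (n34 - f) := ⟨_, rfl⟩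
  obtain ⟨d, hd⟩ : ∃ d, d = min n24 (n12 - a) := ⟨_, rfl⟩
  refine ⟨⟨n12 - a - d, n13 - e, n 2, n23 - a - f, n24 - d, n34 - e - f, a, d, e, f, p, q⟩,
    ?_, ?_⟩
  · clear h0 h1 h3 h4 h5
    obtain rfl | rfl := hp <;> obtain rfl | rfl | rfl := hq <;> constructor <;> dsimp only <;> omega
  · ext i
    fin_cases i <;> simp [leading] <;> omega

end SL4Exponent

/-! ### Bases of monomials in given polynomials -/

section Products

variable {r : ℕ}

theorem Derivation.HasTop.of_apply {A : Type*} [CommRing A] [Algebra ℂ A] {D : Derivation ℂ A A}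
    {f g : A} (h : D f = g) (h' : D g = 0) : D.HasTop f 1 g := by
  simp [Derivation.HasTop, h, h']

/-- A version of `biperfectBasis_of_model` for a family of monomials in given polynomials. -/
theorem biperfectBasis_of_products {J κ : Type*} [Fintype κ] {minor : κ → CoordRing r}
    {wt : κ → Fin (r + 1) → ℤ} {w : PosRoot r → ℕ} {lead : κ → PosRoot r →₀ ℕ}
    {δ : Fin r ⊕ Fin r → κ → ℕ} {dminor : Fin r ⊕ Fin r → κ → CoordRing r} {exps : J → κ → ℕ}
    {μ : J → Fin (r + 1) → ℤ} {ε : Fin r ⊕ Fin r → J → ℕ} {τ : Fin r ⊕ Fin r → J → J} {o : J}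
    (hwt : ∀ k, IsWeightedHomogeneous (entryWeight r) (minor k) (wt k))
    (hlead : ∀ k, HasLeading w (minor k) (lead k))
    (hder : ∀ i k, (simpleDerivation r i).HasTop (minor k) (δ i k) (dminor i k))
    (hμ : ∀ j, ∑ k, exps j k • wt k = μ j)
    (hL : Function.Bijective fun j => ∑ k, exps j k • lead k)
    (hε : ∀ i j, ∑ k, exps j k * δ i k = ε i j)
    (hτ : ∀ i j, ∏ k, dminor i k ^ exps j k = ∏ k, minor k ^ exps (τ i j) k)
    (hinj : ∀ i j j', ε i j = ε i j' → τ i j = τ i j' → j = j')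
    (ho : ∀ k, exps o k = 0) (hker : ∀ j, (∀ i, ε i j = 0) → j = o)
    (hcomp : ∀ j j', μ j = μ j' →
      (∀ i, ε i j < ε i j' ∨ ε i j = 0 ∧ ε i j' = 0) → j = j') :
    IsBiperfectBasis r (Set.range fun j => ∏ k, minor k ^ exps j k) ∧
      ∀ B, IsBiperfectBasis r B → B = Set.range fun j => ∏ k, minor k ^ exps j k := by
  refine biperfectBasis_of_model (fun j => ?_)
    (fun j => HasLeading.prod _ fun k => (hlead k).pow (exps j k)) hL
    (fun i j => ?_) hinj (o := o) (by simp [ho]) hker hcomp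
  · rw [← hμ j]
    exact IsWeightedHomogeneous.prod _ _ _ fun k _ => (hwt k).pow _
  · rw [← hε i j, ← hτ i j]
    exact Derivation.HasTop.prod _ fun k => (hder i k).pow _

theorem isWeightedHomogeneous_mul_sub {σ M : Type*} [AddCommMonoid M] {w : σ → M}
    {f₁ f₂ f₃ : MvPolynomial σ ℂ} {ν₁ ν₂ ν₃ : M} (h₁ : IsWeightedHomogeneous w f₁ ν₁)
    (h₂ : IsWeightedHomogeneous w f₂ ν₂) (h₃ : IsWeightedHomogeneous w f₃ ν₃)
    (h : ν₁ + ν₂ = ν₃) : IsWeightedHomogeneous w (f₁ * f₂ - f₃) ν₃ :=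
  (h ▸ h₁.mul h₂).sub h₃

/-- Weights of the matrix entries, strictly concave as a function of the height. -/
def concaveWeight (r : ℕ) (p : PosRoot r) : ℕ := rootHeight r p * (2 * r + 1 - rootHeight r p)

theorem hasLeading_genericMatrix {w : PosRoot r → ℕ} (p : PosRoot r) :
    HasLeading w (genericMatrix r p.1.1 p.1.2) (Finsupp.single p 1) := by
  rw [genericMatrix_of_lt p.2]
  exact HasLeading.X p

end Products

/-! ### The case of `SL_2` -/

/-- The basis consists of the powers of the single coordinate, written as one-factor products to fit
`biperfectBasis_of_products`. The weight alone determines the exponent. -/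
theorem sl2_biperfectBasis :
    IsBiperfectBasis 1 (Set.range fun n : ℕ => ∏ _k : Fin 1, genericMatrix 1 0 1 ^ n) ∧
      ∀ B, IsBiperfectBasis 1 B →
        B = Set.range fun n : ℕ => ∏ _k : Fin 1, genericMatrix 1 0 1 ^ n := by
  have hp : ∀ p : PosRoot 1, p = ⟨(0, 1), by decide⟩ := by decide
  refine biperfectBasis_of_products (κ := Fin 1) (minor := fun _ => genericMatrix 1 0 1)
    (wt := fun _ => Pi.single 1 1 - Pi.single 0 1) (w := fun _ => 1)
    (lead := fun _ => Finsupp.single ⟨(0, 1), by decide⟩ 1) (δ := fun _ _ => 1)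
    (dminor := fun _ _ => 1) (exps := fun n _ => n)
    (μ := fun n => n • (Pi.single 1 1 - Pi.single 0 1)) (ε := fun _ n => n) (τ := fun _ _ => 0)
    (o := 0) (fun _ => isWeightedHomogeneous_genericMatrix 0 1)
    (fun _ => hasLeading_genericMatrix ⟨(0, 1), by decide⟩) (fun i _ => ?_) (fun _ => by simp)
    ⟨fun n n' h => ?_, fun m => ⟨m ⟨(0, 1), by decide⟩, ?_⟩⟩ (fun _ _ => by simp)
    (fun _ _ => by simp) (fun _ _ _ h _ => h) (fun _ => rfl) (fun _ h => h (.inl 0))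
    (fun n n' h _ => ?_)
  · refine Derivation.HasTop.of_apply ?_ (Derivation.map_one_eq_zero _)
    obtain i | i := i <;> obtain rfl : i = 0 := Subsingleton.elim _ _
    · simp [simpleDerivation_inl_genericMatrix, genericMatrix_self]
    · simp [simpleDerivation_inr_genericMatrix, genericMatrix_self]
  · simpa using DFunLike.congr_fun h ⟨(0, 1), by decide⟩
  · ext p
    rw [hp p]
    simp
  · simpa using congrFun h 1

/-! ### The case of `SL_3` -/

/-- Exponents of the monomials in `x`, `y`, `z` and `xy - z` not divisible by `xy`. -/
@[ext]
structure SL3Exponent where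
  (x y z m : ℕ)
  x_y : x = 0 ∨ y = 0

namespace SL3Exponent

/-- The exponents as a function. -/
def exps (c : SL3Exponent) : Fin 4 → ℕ := ![c.x, c.y, c.z, c.m]

/-- The elements `x`, `y`, `z` and `xy - z`. -/
noncomputable def minor : Fin 4 → CoordRing 2 :=
  ![genericMatrix 2 0 1, genericMatrix 2 1 2, genericMatrix 2 0 2,
    genericMatrix 2 0 1 * genericMatrix 2 1 2 - genericMatrix 2 0 2]

/-- The weights of the minors. -/
def minorWeight : Fin 4 → Fin 3 → ℤ := ![![-1, 1, 0], ![0, -1, 1], ![-1, 0, 1], ![-1, 0, 1]]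

/-- The leading exponents of the minors. -/
noncomputable def minorLead : Fin 4 → PosRoot 2 →₀ ℕ :=
  ![Finsupp.single ⟨(0, 1), by decide⟩ 1, Finsupp.single ⟨(1, 2), by decide⟩ 1,
    Finsupp.single ⟨(0, 2), by decide⟩ 1,
    Finsupp.single ⟨(0, 1), by decide⟩ 1 + Finsupp.single ⟨(1, 2), by decide⟩ 1]

/-- The nilpotence degrees of the minors. -/
def minorDegree : Fin 2 ⊕ Fin 2 → Fin 4 → ℕ :=
  Sum.elim ![![1, 0, 0, 1], ![0, 1, 1, 0]] ![![1, 0, 1, 0], ![0, 1, 0, 1]]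

/-- The normalized top derivatives of the minors, as monomials in the minors `m`. -/
def minorTop {A : Type*} [CommMonoid A] (m : Fin 4 → A) : Fin 2 ⊕ Fin 2 → Fin 4 → A :=
  Sum.elim ![![1, m 1, m 2, m 1], ![m 0, 1, m 0, m 3]] ![![1, m 1, m 1, m 3], ![m 0, 1, m 2, m 0]]

/-- The nilpotence degrees with respect to the simple derivations. -/
def degree (i : Fin 2 ⊕ Fin 2) (c : SL3Exponent) : ℕ :=
  (Sum.elim ![c.x + c.m, c.y + c.z] ![c.x + c.z, c.y + c.m] : Fin 2 ⊕ Fin 2 → ℕ) i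

/-- The exponents of the normalized top derivatives with respect to the simple derivations. -/
def top (i : Fin 2 ⊕ Fin 2) (c : SL3Exponent) : SL3Exponent :=
  (Sum.elim ![⟨0, c.y + c.m, c.z, 0, .inl rfl⟩, ⟨c.x + c.z, 0, 0, c.m, .inr rfl⟩]
    ![⟨0, c.y + c.z, 0, c.m, .inl rfl⟩, ⟨c.x + c.m, 0, c.z, 0, .inr rfl⟩] :
      Fin 2 ⊕ Fin 2 → SL3Exponent) i

/-- The weight of a monomial. -/
def weight (c : SL3Exponent) : Fin 3 → ℤ :=
  ![-(c.x + c.z + c.m), c.x - c.y, c.y + c.z + c.m]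

theorem isWeightedHomogeneous_minor (k : Fin 4) :
    IsWeightedHomogeneous (entryWeight 2) (minor k) (minorWeight k) := by
  have h : ∀ (j k : Fin 3) (ν : Fin 3 → ℤ), Pi.single k 1 - Pi.single j 1 = ν →
      IsWeightedHomogeneous (entryWeight 2) (genericMatrix 2 j k) ν := by
    rintro j k _ rfl
    exact isWeightedHomogeneous_genericMatrix j k
  fin_cases k
  · exact h 0 1 ![-1, 1, 0] (by decide)
  · exact h 1 2 ![0, -1, 1] (by decide)
  · exact h 0 2 ![-1, 0, 1] (by decide)
  · exact isWeightedHomogeneous_mul_sub (h 0 1 _ rfl) (h 1 2 _ rfl)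
      (h 0 2 ![-1, 0, 1] (by decide)) (by decide)

theorem hasLeading_minor (k : Fin 4) : HasLeading (concaveWeight 2) (minor k) (minorLead k) := by
  fin_cases k
  · exact hasLeading_genericMatrix ⟨(0, 1), by decide⟩
  · exact hasLeading_genericMatrix ⟨(1, 2), by decide⟩
  · exact hasLeading_genericMatrix ⟨(0, 2), by decide⟩
  · exact ((hasLeading_genericMatrix ⟨(0, 1), by decide⟩).mul
      (hasLeading_genericMatrix ⟨(1, 2), by decide⟩)).sub
      (hasLeading_genericMatrix ⟨(0, 2), by decide⟩)
      (by simp [Finsupp.weight_single, concaveWeight, rootHeight])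

theorem hasTop_minor (i : Fin 2 ⊕ Fin 2) (k : Fin 4) :
    (simpleDerivation 2 i).HasTop (minor k) (minorDegree i k) (minorTop minor i k) := by
  obtain i | i := i <;> fin_cases i <;> fin_cases k <;>
  simp [Derivation.HasTop, minor, minorDegree, minorTop, Derivation.leibniz,
    simpleDerivation_inl_genericMatrix, simpleDerivation_inr_genericMatrix, genericMatrix_self]

theorem bijective_lead : Function.Bijective fun c : SL3Exponent => ∑ k, c.exps k • minorLead k := by
  have h : ∀ c : SL3Exponent,
      (∑ k, c.exps k • minorLead k) ⟨(0, 1), by decide⟩ = c.x + c.m ∧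
      (∑ k, c.exps k • minorLead k) ⟨(1, 2), by decide⟩ = c.y + c.m ∧
      (∑ k, c.exps k • minorLead k) ⟨(0, 2), by decide⟩ = c.z := by
    intro c
    refine ⟨?_, ?_, ?_⟩ <;> simp [Fin.sum_univ_succ, exps, minorLead]
  constructor
  · intro c c' hc
    obtain ⟨h1, h2, h3⟩ := h c
    obtain ⟨h1', h2', h3'⟩ := h c'
    dsimp only at hc
    rw [hc] at h1 h2 h3
    have := c.x_y
    have := c'.x_y
    ext <;> omega
  · intro m
    obtain ⟨n, hn⟩ : ∃ n, n = min (m ⟨(0, 1), by decide⟩) (m ⟨(1, 2), by decide⟩) := ⟨_, rfl⟩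
    let c : SL3Exponent := ⟨m ⟨(0, 1), by decide⟩ - n, m ⟨(1, 2), by decide⟩ - n,
      m ⟨(0, 2), by decide⟩, n, by omega⟩
    have hp : ∀ p : PosRoot 2, p = ⟨(0, 1), by decide⟩ ∨ p = ⟨(1, 2), by decide⟩ ∨
      p = ⟨(0, 2), by decide⟩ := by decide
    obtain ⟨h1, h2, h3⟩ := h c
    refine ⟨c, Finsupp.ext fun p => ?_⟩
    obtain rfl | rfl | rfl := hp p
    · exact h1.trans (by simp only [c]; omega)
    · exact h2.trans (by simp only [c]; omega)
    · exact h3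

theorem prod_minorTop {A : Type*} [CommSemiring A] (m : Fin 4 → A) (c : SL3Exponent)
    (i : Fin 2 ⊕ Fin 2) : ∏ k, minorTop m i k ^ c.exps k = ∏ k, m k ^ (top i c).exps k := by
  obtain i | i := i <;> fin_cases i <;>
  simp [Fin.prod_univ_succ, exps, minorTop, top] <;> ring

theorem biperfectBasis :
    IsBiperfectBasis 2 (Set.range fun c : SL3Exponent => ∏ k, minor k ^ c.exps k) ∧
      ∀ B, IsBiperfectBasis 2 B →
        B = Set.range fun c : SL3Exponent => ∏ k, minor k ^ c.exps k := by
  refine biperfectBasis_of_products (μ := weight) (ε := degree) (τ := top)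
    (o := ⟨0, 0, 0, 0, .inl rfl⟩) isWeightedHomogeneous_minor hasLeading_minor hasTop_minor
    (fun c => ?_) bijective_lead (fun i c => ?_)
    (fun i c => prod_minorTop minor c i) (fun i c c' hε hτ => ?_)
    (fun k => by fin_cases k <;> rfl) (fun c h => ?_) (fun c c' hμ h => ?_)
  · ext i
    fin_cases i <;> simp [Fin.sum_univ_succ, exps, minorWeight, weight] <;> ring
  · obtain i | i := i <;> fin_cases i <;>
    simp [Fin.sum_univ_succ, exps, minorDegree, degree]
  · have := c.x_y
    have := c'.x_y
    obtain i | i := i <;> fin_cases i <;> simp [degree, top] at hε hτ <;> ext <;> omega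
  · have h1 := h (.inl 0)
    have h2 := h (.inl 1)
    simp [degree] at h1 h2
    ext <;> dsimp only <;> omega
  -- The weight determines `x - y`, hence `x` and `y`, and then `z + m`. So `z` and `m` cannot both
  -- increase, and one of the degrees `x + m`, `x + z` must vanish on both sides.
  · have h1 := h (.inl 0)
    have h2 := h (.inl 1)
    have h3 := h (.inr 0)
    have h4 := h (.inr 1)
    have w1 := congrFun hμ 0
    have w2 := congrFun hμ 1
    have := c.x_y
    have := c'.x_y
    simp [degree, weight] at h1 h2 h3 h4 w1 w2
    ext <;> omega

theorem range_eq_sl3Basis :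
    (Set.range fun c : SL3Exponent => ∏ k, minor k ^ c.exps k) = sl3Basis := by
  ext f
  constructor
  · rintro ⟨⟨x, y, z, m, rfl | rfl⟩, rfl⟩
    · exact Or.inr ⟨y, z, m, by simp [Fin.prod_univ_succ, exps, minor, mul_assoc]⟩
    · exact Or.inl ⟨x, z, m, by simp [Fin.prod_univ_succ, exps, minor, mul_assoc]⟩
  · rintro (⟨a, b, c, rfl⟩ | ⟨a, b, c, rfl⟩)
    · exact ⟨⟨a, 0, b, c, .inr rfl⟩, by simp [Fin.prod_univ_succ, exps, minor, mul_assoc]⟩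
    · exact ⟨⟨0, a, b, c, .inl rfl⟩, by simp [Fin.prod_univ_succ, exps, minor, mul_assoc]⟩

end SL3Exponent

/-! ### The case of `SL_4` -/

namespace SL4Exponent

/-- The exponents as a function. -/
def exps (c : SL4Exponent) : Fin 12 → ℕ :=
  ![c.x12, c.x13, c.x14, c.x23, c.x24, c.x34, c.a, c.d, c.e, c.f, c.p, c.q]

/-- The minor with rows `23` and columns `34`. -/
noncomputable def minorF : CoordRing 3 :=
  genericMatrix 3 1 2 * genericMatrix 3 2 3 - genericMatrix 3 1 3

/-- The minor with rows `13` and columns `34`. -/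
noncomputable def minorE : CoordRing 3 :=
  genericMatrix 3 0 2 * genericMatrix 3 2 3 - genericMatrix 3 0 3

/-- The twelve irreducible minors. -/
noncomputable def minor : Fin 12 → CoordRing 3 :=
  ![genericMatrix 3 0 1, genericMatrix 3 0 2, genericMatrix 3 0 3, genericMatrix 3 1 2,
    genericMatrix 3 1 3, genericMatrix 3 2 3,
    genericMatrix 3 0 1 * genericMatrix 3 1 2 - genericMatrix 3 0 2,
    genericMatrix 3 0 1 * genericMatrix 3 1 3 - genericMatrix 3 0 3,
    minorE, minorF,
    genericMatrix 3 0 2 * genericMatrix 3 1 3 - genericMatrix 3 0 3 * genericMatrix 3 1 2,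
    genericMatrix 3 0 1 * minorF - minorE]

/-- The weights of the minors. -/
def minorWeight : Fin 12 → Fin 4 → ℤ :=
  ![![-1, 1, 0, 0], ![-1, 0, 1, 0], ![-1, 0, 0, 1], ![0, -1, 1, 0], ![0, -1, 0, 1], ![0, 0, -1, 1],
    ![-1, 0, 1, 0], ![-1, 0, 0, 1], ![-1, 0, 0, 1], ![0, -1, 0, 1], ![-1, -1, 1, 1], ![-1, 0, 0, 1]]

/-- The positions of the matrix entries, in lexicographic order. -/
def position : Fin 6 → PosRoot 3 :=
  ![⟨(0, 1), by decide⟩, ⟨(0, 2), by decide⟩, ⟨(0, 3), by decide⟩, ⟨(1, 2), by decide⟩,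
    ⟨(1, 3), by decide⟩, ⟨(2, 3), by decide⟩]

/-- The leading exponents of the minors. -/
noncomputable def minorLead : Fin 12 → PosRoot 3 →₀ ℕ :=
  let s (i : Fin 6) : PosRoot 3 →₀ ℕ := Finsupp.single (position i) 1
  ![s 0, s 1, s 2, s 3, s 4, s 5, s 0 + s 3, s 0 + s 4, s 1 + s 5, s 3 + s 5, s 1 + s 4,
    s 0 + (s 3 + s 5)]

/-- The nilpotence degrees of the minors. -/
def minorDegree : Fin 3 ⊕ Fin 3 → Fin 12 → ℕ :=
  Sum.elim
    ![![1, 0, 0, 0, 0, 0, 1, 1, 0, 0, 0, 1], ![0, 1, 0, 1, 0, 0, 0, 0, 1, 1, 1, 0],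
      ![0, 0, 1, 0, 1, 1, 0, 1, 0, 0, 0, 0]]
    ![![1, 1, 1, 0, 0, 0, 0, 0, 1, 0, 0, 0], ![0, 0, 0, 1, 1, 0, 1, 1, 0, 0, 1, 0],
      ![0, 0, 0, 0, 0, 1, 0, 0, 1, 1, 0, 1]]

/-- The normalized top derivatives of the minors, as monomials in the minors `m`. -/
def minorTop {A : Type*} [CommMonoid A] (m : Fin 12 → A) : Fin 3 ⊕ Fin 3 → Fin 12 → A :=
  Sum.elim
    ![![1, m 1, m 2, m 3, m 4, m 5, m 3, m 4, m 8, m 9, m 10, m 9],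
      ![m 0, m 0, m 2, 1, m 4, m 5, m 6, m 7, m 0 * m 5, m 5, m 7, m 11],
      ![m 0, m 1, m 1, m 3, m 3, 1, m 6, m 6, m 8, m 9, m 10, m 11]]
    ![![1, m 3, m 4, m 3, m 4, m 5, m 6, m 7, m 9, m 9, m 10, m 11],
      ![m 0, m 1, m 2, 1, m 5, m 5, m 0, m 0 * m 5, m 8, m 9, m 8, m 11],
      ![m 0, m 1, m 2, m 3, m 4, 1, m 6, m 7, m 1, m 3, m 10, m 6]]

/-- The weight of a monomial. -/
def weight (c : SL4Exponent) : Fin 4 → ℤ :=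
  ![-c.rootCoeff 0, c.rootCoeff 0 - c.rootCoeff 1, c.rootCoeff 1 - c.rootCoeff 2, c.rootCoeff 2]

theorem isWeightedHomogeneous_minor (k : Fin 12) :
    IsWeightedHomogeneous (entryWeight 3) (minor k) (minorWeight k) := by
  have h : ∀ (j k : Fin 4) (ν : Fin 4 → ℤ), Pi.single k 1 - Pi.single j 1 = ν →
      IsWeightedHomogeneous (entryWeight 3) (genericMatrix 3 j k) ν := by
    rintro j k _ rfl
    exact isWeightedHomogeneous_genericMatrix j k
  have hE : IsWeightedHomogeneous (entryWeight 3) minorE ![-1, 0, 0, 1] :=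
    isWeightedHomogeneous_mul_sub (h 0 2 _ rfl) (h 2 3 _ rfl) (h 0 3 _ (by decide)) (by decide)
  have hF : IsWeightedHomogeneous (entryWeight 3) minorF ![0, -1, 0, 1] :=
    isWeightedHomogeneous_mul_sub (h 1 2 _ rfl) (h 2 3 _ rfl) (h 1 3 _ (by decide)) (by decide)
  fin_cases k
  · exact h 0 1 ![-1, 1, 0, 0] (by decide)
  · exact h 0 2 ![-1, 0, 1, 0] (by decide)
  · exact h 0 3 ![-1, 0, 0, 1] (by decide)
  · exact h 1 2 ![0, -1, 1, 0] (by decide)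
  · exact h 1 3 ![0, -1, 0, 1] (by decide)
  · exact h 2 3 ![0, 0, -1, 1] (by decide)
  · exact isWeightedHomogeneous_mul_sub (h 0 1 _ rfl) (h 1 2 _ rfl)
      (h 0 2 ![-1, 0, 1, 0] (by decide)) (by decide)
  · exact isWeightedHomogeneous_mul_sub (h 0 1 _ rfl) (h 1 3 _ rfl)
      (h 0 3 ![-1, 0, 0, 1] (by decide)) (by decide)
  · exact hE
  · exact hF
  · exact isWeightedHomogeneous_mul_sub (ν₃ := ![-1, -1, 1, 1]) (h 0 2 _ rfl) (h 1 3 _ rfl)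
      ((show (![-1, 0, 0, 1] : Fin 4 → ℤ) + ![0, -1, 1, 0] = ![-1, -1, 1, 1] by decide) ▸
        (h 0 3 _ (by decide)).mul (h 1 2 _ (by decide))) (by decide)
  · exact isWeightedHomogeneous_mul_sub (h 0 1 _ rfl) hF hE (by decide)

theorem hasLeading_minor (k : Fin 12) : HasLeading (concaveWeight 3) (minor k) (minorLead k) := by
  have h : ∀ i : Fin 6, HasLeading (concaveWeight 3)
      (genericMatrix 3 (position i).1.1 (position i).1.2) (Finsupp.single (position i) 1) :=
    fun i => hasLeading_genericMatrix (position i)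
  have hE := ((h 1).mul (h 5)).sub (h 2)
    (by simp [Finsupp.weight_single, concaveWeight, rootHeight, position])
  have hF := ((h 3).mul (h 5)).sub (h 4)
    (by simp [Finsupp.weight_single, concaveWeight, rootHeight, position])
  fin_cases k
  · exact h 0
  · exact h 1
  · exact h 2
  · exact h 3
  · exact h 4
  · exact h 5
  · exact ((h 0).mul (h 3)).sub (h 1)
      (by simp [Finsupp.weight_single, concaveWeight, rootHeight, position])
  · exact ((h 0).mul (h 4)).sub (h 2)
      (by simp [Finsupp.weight_single, concaveWeight, rootHeight, position])
  · exact hE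
  · exact hF
  · exact ((h 1).mul (h 4)).sub ((h 2).mul (h 3))
      (by simp [Finsupp.weight_single, concaveWeight, rootHeight, position])
  · exact ((h 0).mul hF).sub hE
      (by simp [Finsupp.weight_single, concaveWeight, rootHeight, position])

/-- A simple derivation replaces one column (or row) index by its neighbour, so it sends a minor to
zero or to another minor, possibly a reducible one such as `x12 * x34`. Every degree is thus 0 or 1.
-/
theorem hasTop_minor (i : Fin 3 ⊕ Fin 3) (k : Fin 12) :
    (simpleDerivation 3 i).HasTop (minor k) (minorDegree i k) (minorTop minor i k) := by
  obtain i | i := i <;> fin_cases i <;> fin_cases k <;> refine ⟨?_, ?_⟩ <;>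
  simp [minor, minorE, minorF, minorDegree, minorTop, Derivation.leibniz,
    simpleDerivation_inl_genericMatrix, simpleDerivation_inr_genericMatrix, genericMatrix_self] <;>
  ring

end SL4Exponent

/-! ### Exponent bookkeeping and conclusion for `SL_4` -/

namespace SL4Exponent

theorem sum_minorLead_position (c : SL4Exponent) (i : Fin 6) :
    (∑ k, c.exps k • minorLead k) (position i) = c.leading i := by
  have hinj : Function.Injective position := by decide
  fin_cases i <;>
  simp [Fin.sum_univ_succ, exps, minorLead, leading, hinj.eq_iff] <;> ring

theorem bijective_lead : Function.Bijective
    fun c : {c : SL4Exponent // c.Noncrossing} => ∑ k, c.1.exps k • minorLead k := by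
  constructor
  · rintro ⟨c, hc⟩ ⟨c', hc'⟩ h
    dsimp only at h
    refine Subtype.ext (hc.eq_of_leading_eq hc' (funext fun i => ?_))
    rw [← sum_minorLead_position, ← sum_minorLead_position, h]
  · intro m
    obtain ⟨c, hc, hm⟩ := exists_leading_eq fun i => m (position i)
    have hsurj : Function.Surjective position := by decide
    refine ⟨⟨c, hc⟩, Finsupp.ext fun p => ?_⟩
    obtain ⟨i, rfl⟩ := hsurj p
    exact (sum_minorLead_position c i).trans (congrFun hm i)

theorem rootCoeff_eq_of_weight_eq {c c' : SL4Exponent} (h : c.weight = c'.weight) :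
    c.rootCoeff = c'.rootCoeff := by
  have h0 := congrFun h 0
  have h1 := congrFun h 1
  have h3 := congrFun h 3
  simp only [weight, Matrix.cons_val] at h0 h1 h3
  ext i
  fin_cases i <;> dsimp only <;> simp only [Fin.zero_eta, Fin.mk_one, Fin.reduceFinMk] <;> omega

theorem sum_minorWeight (c : SL4Exponent) : ∑ k, c.exps k • minorWeight k = c.weight := by
  ext i
  fin_cases i <;> simp [Fin.sum_univ_succ, exps, minorWeight, weight, rootCoeff] <;> ring

theorem sum_minorDegree (c : SL4Exponent) (i : Fin 3 ⊕ Fin 3) :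
    ∑ k, c.exps k * minorDegree i k = c.degree i := by
  obtain i | i := i <;> fin_cases i <;>
  simp [Fin.sum_univ_succ, exps, minorDegree, degree] <;> ring

/-- Only exponents are collected here, with no relation between the minors, so the identity is
stated for arbitrary elements `m`. -/
theorem prod_minorTop {A : Type*} [CommSemiring A] (m : Fin 12 → A) (c : SL4Exponent)
    (i : Fin 3 ⊕ Fin 3) : ∏ k, minorTop m i k ^ c.exps k = ∏ k, m k ^ (c.top i).exps k := by
  obtain i | i := i <;> fin_cases i <;>
  simp [Fin.prod_univ_succ, exps, minorTop, top, -mul_eq_mul_left_iff, -mul_eq_mul_right_iff] <;>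
  ring

theorem eq_zero_of_degree_eq_zero {c : SL4Exponent} (h : ∀ i, c.degree i = 0) :
    c = ⟨0, 0, 0, 0, 0, 0, 0, 0, 0, 0, 0, 0⟩ := by
  have h1 := h (.inl 0)
  have h2 := h (.inl 1)
  have h3 := h (.inl 2)
  simp [degree] at h1 h2 h3
  ext <;> dsimp only <;> omega

theorem biperfectBasis :
    IsBiperfectBasis 3
        (Set.range fun c : {c : SL4Exponent // c.Noncrossing} => ∏ k, minor k ^ c.1.exps k) ∧
      ∀ B, IsBiperfectBasis 3 B →
        B = Set.range fun c : {c : SL4Exponent // c.Noncrossing} => ∏ k, minor k ^ c.1.exps k :=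
  biperfectBasis_of_products (μ := fun c => c.1.weight) (ε := fun i c => c.1.degree i)
    (τ := fun i c => ⟨c.1.top i, c.2.top i⟩)
    (o := ⟨⟨0, 0, 0, 0, 0, 0, 0, 0, 0, 0, 0, 0⟩, by constructor <;> simp⟩)
    isWeightedHomogeneous_minor hasLeading_minor hasTop_minor
    (fun c => sum_minorWeight c.1) bijective_lead (fun i c => sum_minorDegree c.1 i)
    (fun i c => prod_minorTop minor c.1 i)
    (fun i c c' hε hτ => Subtype.ext (c.2.eq_of_top_eq c'.2 i hε (congrArg Subtype.val hτ)))
    (fun k => by fin_cases k <;> rfl)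
    (fun _ h => Subtype.ext (eq_zero_of_degree_eq_zero h))
    (fun _ c' hμ h => Subtype.ext (c'.2.eq_of_degree_lt (rootCoeff_eq_of_weight_eq hμ) h))

end SL4Exponent

theorem theorem1p7 :
    (∃! B : Set (CoordRing 1), IsBiperfectBasis 1 B) ∧
    (∃! B : Set (CoordRing 2), IsBiperfectBasis 2 B) ∧
    (∃! B : Set (CoordRing 3), IsBiperfectBasis 3 B) ∧
    IsBiperfectBasis 2 sl3Basis :=
  ⟨⟨_, sl2_biperfectBasis⟩, ⟨_, SL3Exponent.biperfectBasis⟩, ⟨_, SL4Exponent.biperfectBasis⟩,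
    SL3Exponent.range_eq_sl3Basis ▸ SL3Exponent.biperfectBasis.1⟩
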